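/- A multiplicative distance function is a function $\Phi:\mathbb{C}[x]\to[0,\infty)$ that is continuous in the coefficients on polynomials of bounded degree and satisfies $\Phi(f)=0\iff f=0$, $\Phi(wf)=|w|\,\Phi(f)$ and $\Phi(fg)=\Phi(f)\Phi(g)$ for all $f,g\in\mathbb{C}[x]$, $w\in\mathbb{C}$. Its root function is $\phi(\gamma)=\Phi(x-\gamma)$ for $\gamma\in\mathbb{C}$, and its real degree $N$ moment function is \[ F_N(\Phi;s)=\int_{\mathbb{R}^N}\Phi\Big(x^N+\sum_{n=1}^N b_n x^{N-n}\Big)^{-s}\,d\lambda_N(\mathbf{b}), \] where $\lambda_N$ is Lebesgue measure. For polynomials $P,Q$ put $\langle P,Q\rangle=\langle P,Q\rangle_{\mathbb{R}}+\langle P,Q\rangle_{\mathbb{C}}$ with \[ \langle P,Q\rangle_{\mathbb{R}}=\int_{\mathbb{R}^2}\phi(x)^{-s}\phi(y)^{-s}P(x)Q(y)\,\mathrm{sgn}(y-x)\,dx\,dy, \] \[ \langle P,Q\rangle_{\mathbb{C}}=-2i\int_{\mathbb{C}}\phi(\beta)^{-s}\phi(\overline\beta)^{-s}P(\overline\beta)Q(\beta)\,\mathrm{sgn}(\operatorname{Im}\beta)\,d\lambda_2(\beta).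 \] \textbf{Corollary 3.} Let $\Phi$ be a multiplicative distance function whose root function satisfies $\phi(-\beta)=\phi(\beta)$ for every $\beta\in\mathbb{C}$. Let $N\ge 0$ be an integer, let $J$ be the integer part of $(N+1)/2$, and let $s\in\mathbb{C}$ with $\operatorname{Re}(s)>N$. Let $\mathbf{P}=\{P_1,\dots,P_N\}$ be monic polynomials in $\mathbb{R}[x]$ with $\deg P_n=n-1$ such that $P_n$ is even when $n-1$ is even and odd when $n-1$ is odd. Let $U_{\mathbf{P}}$ be the $2J\times 2J$ antisymmetric matrix with entries \[ U_{\mathbf{P}}[j,k]=\begin{cases}\langle P_j,P_k\rangle & \text{if } j,k\le N,\\[2pt] \mathrm{sgn}(k-j)\displaystyle\int_{\mathbb{R}}\phi(x)^{-s}P_{\min\{j,k\}}(x)\,dx & \text{otherwise}\end{cases} \] (the diagonal entry with $j=k=N+1$, which occurs when $N$ is odd, is $0$). Then the integral defining $F_N(\Phi;s)$, the integrals defining $\langle P_j,P_k\rangle_{\mathbb{R}}$ and $\langle P_j,P_k\rangle_{\mathbb{C}}$ for $1\le j,k\le N$, and the integrals $\int_{\mathbb{R}}\phi(x)^{-s}P_j(x)\,dx$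 for $1\le j\le N$ all converge absolutely, and \[ F_N(\Phi;s)=\det A_{\mathbf{P}}, \] where $A_{\mathbf{P}}$ is the $J\times J$ matrix with entries $A_{\mathbf{P}}[j,k]=U_{\mathbf{P}}[2j-1,2k]$. -/

import Mathlib

open MeasureTheory

namespace MultDist

/-- A multiplicative distance function on `ℂ[x]`: a non-negative function which is continuous
(as a function of the coefficient vector, on polynomials of bounded degree), positive definite,
absolutely homogeneous and multiplicative. -/
structure IsMultiplicativeDistance (Φ : Polynomial ℂ → ℝ) : Prop where
  nonneg : ∀ f, 0 ≤ Φ f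
  continuous : ∀ n : ℕ, Continuous fun a : Fin n → ℂ =>
    Φ (∑ i : Fin n, Polynomial.C (a i) * Polynomial.X ^ (i : ℕ))
  eq_zero_iff : ∀ f, Φ f = 0 ↔ f = 0
  homogeneous : ∀ (w : ℂ) (f : Polynomial ℂ), Φ (Polynomial.C w * f) = ‖w‖ * Φ f
  map_mul : ∀ f g, Φ (f * g) = Φ f * Φ g

/-- The root function `φ(γ) = Φ(x - γ)`. -/
noncomputable def rootFunction (Φ : Polynomial ℂ → ℝ) (γ : ℂ) : ℝ :=
  Φ (Polynomial.X - Polynomial.C γ)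

/-- The degree `N` monic restriction
`b ↦ Φ(x^N + b₁ x^(N-1) + ⋯ + b_N)`; the coordinate `b_(n+1)` is `b n`. -/
noncomputable def monicRestriction (Φ : Polynomial ℂ → ℝ) (N : ℕ) (b : Fin N → ℂ) : ℝ :=
  Φ (Polynomial.X ^ N +
    ∑ n : Fin N, Polynomial.C (b n) * Polynomial.X ^ (N - ((n : ℕ) + 1)))

/-- The function of `b ∈ ℝ^N` whose Lebesgue integral is the real moment function. -/
noncomputable def momentIntegrand (Φ : Polynomial ℂ → ℝ) (N : ℕ) (s : ℂ) (b : Fin N → ℝ) : ℂ :=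
  (monicRestriction Φ N (fun n => (b n : ℂ)) : ℂ) ^ (-s)

/-- The real degree `N` moment function `F_N(Φ; s)`. -/
noncomputable def momentFunction (Φ : Polynomial ℂ → ℝ) (N : ℕ) (s : ℂ) : ℂ :=
  ∫ b : Fin N → ℝ, momentIntegrand Φ N s b

/-- The integrand of `⟨P, Q⟩_ℝ`, as a function of `(x, y) ∈ ℝ²`. -/
noncomputable def realIntegrand (Φ : Polynomial ℂ → ℝ) (s : ℂ) (P Q : Polynomial ℂ)
    (p : ℝ × ℝ) : ℂ :=
  (rootFunction Φ (p.1 : ℂ) : ℂ) ^ (-s) * (rootFunction Φ (p.2 : ℂ) : ℂ) ^ (-s) *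
    P.eval (p.1 : ℂ) * Q.eval (p.2 : ℂ) * (Real.sign (p.2 - p.1) : ℂ)

/-- The integrand of `⟨P, Q⟩_ℂ` (without the factor `-2i`), as a function of `β ∈ ℂ`. -/
noncomputable def complexIntegrand (Φ : Polynomial ℂ → ℝ) (s : ℂ) (P Q : Polynomial ℂ)
    (β : ℂ) : ℂ :=
  (rootFunction Φ β : ℂ) ^ (-s) * (rootFunction Φ (starRingEnd ℂ β) : ℂ) ^ (-s) *
    P.eval (starRingEnd ℂ β) * Q.eval β * (Real.sign β.im : ℂ)

/-- The integrand `φ(x)^(-s) P(x)` on the real line. -/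
noncomputable def lineIntegrand (Φ : Polynomial ℂ → ℝ) (s : ℂ) (P : Polynomial ℂ) (x : ℝ) : ℂ :=
  (rootFunction Φ (x : ℂ) : ℂ) ^ (-s) * P.eval (x : ℂ)

/-- The skew-symmetric form `⟨P, Q⟩_ℝ`. -/
noncomputable def realForm (Φ : Polynomial ℂ → ℝ) (s : ℂ) (P Q : Polynomial ℂ) : ℂ :=
  ∫ p : ℝ × ℝ, realIntegrand Φ s P Q p

/-- The skew-symmetric form `⟨P, Q⟩_ℂ`. -/
noncomputable def complexForm (Φ : Polynomial ℂ → ℝ) (s : ℂ) (P Q : Polynomial ℂ) : ℂ :=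
  -2 * Complex.I * ∫ β : ℂ, complexIntegrand Φ s P Q β

/-- The skew-symmetric form `⟨P, Q⟩ = ⟨P, Q⟩_ℝ + ⟨P, Q⟩_ℂ`. -/
noncomputable def skewForm (Φ : Polynomial ℂ → ℝ) (s : ℂ) (P Q : Polynomial ℂ) : ℂ :=
  realForm Φ s P Q + complexForm Φ s P Q

/-- The antisymmetric `2J × 2J` matrix `U_P`, where `J` is the integer part of `(N+1)/2`.
Indices start at `0`: the index `j : Fin (2J)` stands for `j + 1`, and `P j` for `P_(j+1)`.
The last case occurs only for `N` odd and `j = k = N`, a diagonal entry, where `sgn(k - j) = 0`. -/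
noncomputable def matrixU (Φ : Polynomial ℂ → ℝ) (s : ℂ) {N : ℕ} (P : Fin N → Polynomial ℂ) :
    Matrix (Fin (2 * ((N + 1) / 2))) (Fin (2 * ((N + 1) / 2))) ℂ :=
  Matrix.of fun j k =>
    if h : (j : ℕ) < N ∧ (k : ℕ) < N then
      skewForm Φ s (P ⟨j, h.1⟩) (P ⟨k, h.2⟩)
    else if h' : min (j : ℕ) (k : ℕ) < N then
      (Real.sign ((k : ℝ) - (j : ℝ)) : ℂ) *
        ∫ x : ℝ, lineIntegrand Φ s (P ⟨min (j : ℕ) (k : ℕ), h'⟩) x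
    else 0

/-- The `J × J` matrix `A_P[j,k] = U_P[2j-1, 2k]`. With indices starting at `0`, the row `2j-1`
and the column `2k` of `U_P` become `2j` and `2k+1`. -/
noncomputable def matrixA (Φ : Polynomial ℂ → ℝ) (s : ℂ) {N : ℕ} (P : Fin N → Polynomial ℂ) :
    Matrix (Fin ((N + 1) / 2)) (Fin ((N + 1) / 2)) ℂ :=
  Matrix.of fun j k =>
    matrixU Φ s P ⟨2 * (j : ℕ), by omega⟩ ⟨2 * (k : ℕ) + 1, by omega⟩

end MultDist

/-!
Multiplication `(q, r) ↦ q r` of monic real polynomials, read on coefficients, has the resultant of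
`q` and `r` as its Jacobian. The fibre of a separable polynomial consists of its finitely many
factorisations, and since its derivative alternates in sign along the real roots, the signs of the
resultants of the factorisations with `q` quadratic add up to half the degree, rounded down. By the
area formula the iterated integral over `q` and `r`, weighted by the resultant, is therefore that
multiple of the integral over monic polynomials `q r`, and `J` iterations leave `J` quadratic
factors and a remainder of degree `0` or `1`.

The product of all the resultants and of the root differences of the quadratic factors is a
Vandermonde determinant, hence `det (P_j (root_i))` for any monic `P_j` of degree `j`. Since `Φ` is
multiplicative, the Leibniz expansion of this determinant turns the integral into a signed sum over
permutations of products of integrals, each over the root pairs of one quadratic: real pairs `x < y`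
and conjugate pairs with the root in the upper half plane. This pairing is symmetric in two
polynomials of the same parity, so only permutations that pair even with odd indices survive, and
they assemble into `J! * det A`.
-/

namespace MultDist

section AreaFormula

open Set Function TopologicalSpace

theorem hasSum_indicator_image {ι α β : Type*} {F : α → β} {t : ι → Set α} {w : α → ℝ} {c : ι → ℝ}
    (hdisj : Pairwise (Disjoint on t)) (hinj : ∀ i, InjOn F (t i))
    (hwt : ∀ i, ∀ x ∈ t i, w x = c i) (hw0 : ∀ x, (∀ i, x ∉ t i) → w x = 0)
    {y : β} {S : Finset α} (hS : ∀ x, x ∈ S ↔ F x = y) :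
    HasSum (fun i => (F '' t i).indicator (fun _ => c i) y) (∑ x ∈ S, w x) := by
  have hsum : ∀ i, (F '' t i).indicator (fun _ => c i) y = ∑ x ∈ S, (t i).indicator w x := by
    intro i
    by_cases hy : y ∈ F '' t i
    · obtain ⟨x, hx, rfl⟩ := hy
      rw [indicator_of_mem (mem_image_of_mem F hx), Finset.sum_eq_single_of_mem x ((hS x).2 rfl),
        indicator_of_mem hx, hwt i x hx]
      exact fun z hz hzx => indicator_of_notMem (fun hzt => hzx (hinj i hzt hx ((hS z).1 hz))) _
    · rw [indicator_of_notMem hy, Finset.sum_eq_zero]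
      exact fun x hx => indicator_of_notMem (fun hxt => hy ⟨x, hxt, (hS x).1 hx⟩) _
  simp_rw [hsum]
  refine hasSum_sum fun x _ => ?_
  by_cases hx : ∃ i, x ∈ t i
  · obtain ⟨i, hi⟩ := hx
    rw [← indicator_of_mem hi w]
    exact hasSum_single i fun j hj =>
      indicator_of_notMem (fun hxj => disjoint_left.1 (hdisj hj) hxj hi) _
  · rw [not_exists] at hx
    simp only [hw0 x hx, indicator_of_notMem (hx _), hasSum_zero]

theorem sum_abs_indicator_image_le {ι α β : Type*} {F : α → β} {t : ι → Set α} {w : α → ℝ}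
    {c : ι → ℝ} (hdisj : Pairwise (Disjoint on t)) (hinj : ∀ i, InjOn F (t i))
    (hwt : ∀ i, ∀ x ∈ t i, w x = c i) (hw0 : ∀ x, (∀ i, x ∉ t i) → w x = 0)
    {y : β} {S : Finset α} (hS : ∀ x, x ∈ S ↔ F x = y) (s : Finset ι) :
    ∑ i ∈ s, |(F '' t i).indicator (fun _ => c i) y| ≤ ∑ x ∈ S, |w x| := by
  have habs : HasSum (fun i => |(F '' t i).indicator (fun _ => c i) y|) (∑ x ∈ S, |w x|) := by
    simp only [← Real.norm_eq_abs, norm_indicator_eq_indicator_norm]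
    exact hasSum_indicator_image hdisj hinj (fun i x hx => by rw [hwt i x hx])
      (fun x hx => by rw [hw0 x hx, norm_zero]) hS
  exact sum_le_hasSum s (fun i _ => abs_nonneg _) habs

variable {E G : Type*} [NormedAddCommGroup E] [NormedSpace ℝ E] [FiniteDimensional ℝ E]
  [NormedAddCommGroup G] [NormedSpace ℝ G] {F : E → E} {F' : E → E →L[ℝ] E}

theorem exists_isOpen_injOn_of_det_ne_zero (hF : ∀ x, HasFDerivAt F (F' x) x)
    (hF' : Continuous F') {x : E} (hx : (F' x).det ≠ 0) : ∃ U, IsOpen U ∧ x ∈ U ∧ InjOn F U := by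
  have hstrict : HasStrictFDerivAt F
      ((F' x).toContinuousLinearEquivOfDetNeZero hx : E →L[ℝ] E) x :=
    hasStrictFDerivAt_of_hasFDerivAt_of_continuousAt (.of_forall hF) hF'.continuousAt
  let e := hstrict.toOpenPartialHomeomorph F
  exact ⟨e.source, e.open_source, hstrict.mem_toOpenPartialHomeomorph_source, e.injOn⟩

theorem measurableSet_preimage_sign (ε : SignType) :
    MeasurableSet (SignType.sign ⁻¹' {ε} : Set ℝ) := by
  cases ε with
  | zero => exact (measurableSet_singleton 0).congr (ext fun _ => sign_eq_zero_iff.symm)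
  | neg => exact measurableSet_Iio.congr (ext fun _ => sign_eq_neg_one_iff.symm)
  | pos => exact measurableSet_Ioi.congr (ext fun _ => sign_eq_one_iff.symm)

theorem abs_coe_sign_le_one (ε : SignType) : |(ε : ℝ)| ≤ 1 := by
  cases ε <;> simp

variable [MeasurableSpace E] [BorelSpace E]

theorem exists_measurable_partition_injOn (hF : ∀ x, HasFDerivAt F (F' x) x)
    (hF' : Continuous F') : ∃ t : ℕ → Set E, (∀ n, MeasurableSet (t n)) ∧
      Pairwise (Disjoint on t) ∧ ⋃ n, t n = {x | (F' x).det ≠ 0} ∧ ∀ n, InjOn F (t n) := by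
  obtain ⟨u, hu⟩ := (((countable_countableBasis E).mono
    (sep_subset _ (InjOn F))).insert ∅).exists_eq_range (insert_nonempty _ _)
  have hmem : ∀ n, u n = ∅ ∨ u n ∈ countableBasis E ∧ InjOn F (u n) := fun n =>
    hu.superset (mem_range_self n)
  have hinj : ∀ n, InjOn F (u n) := fun n => (hmem n).elim (fun h => h ▸ injOn_empty F) And.right
  have hopen : ∀ n, IsOpen (u n) := fun n =>
    (hmem n).elim (fun h => h ▸ isOpen_empty) fun h => isOpen_of_mem_countableBasis h.1
  have hs : MeasurableSet {x | (F' x).det ≠ 0} :=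
    (isOpen_ne_fun (ContinuousLinearMap.continuous_det.comp hF') continuous_const).measurableSet
  refine ⟨fun n => {x | (F' x).det ≠ 0} ∩ disjointed u n,
    fun n => hs.inter (.disjointed (fun n => (hopen n).measurableSet) n),
    fun i j hij => (disjoint_disjointed u hij).mono inter_subset_right inter_subset_right, ?_,
    fun n => (hinj n).mono (inter_subset_right.trans (disjointed_subset u n))⟩
  rw [← inter_iUnion, iUnion_disjointed, inter_eq_left]
  intro x hx
  obtain ⟨U, hU, hxU, hUinj⟩ := exists_isOpen_injOn_of_det_ne_zero hF hF' hx
  obtain ⟨b, hb, hxb, hbU⟩ := (isBasis_countableBasis E).exists_subset_of_mem_open hxU hU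
  obtain ⟨n, rfl⟩ := hu.subset (mem_insert_of_mem _ ⟨hb, hUinj.mono hbU⟩)
  exact mem_iUnion.2 ⟨n, hxb⟩

theorem exists_measurable_partition_injOn_sign_det (hF : ∀ x, HasFDerivAt F (F' x) x)
    (hF' : Continuous F') : ∃ t : ℕ × SignType → Set E, (∀ i, MeasurableSet (t i)) ∧
      Pairwise (Disjoint on t) ∧ ⋃ i, t i = {x | (F' x).det ≠ 0} ∧ (∀ i, InjOn F (t i)) ∧
      ∀ i, ∀ x ∈ t i, SignType.sign (F' x).det = i.2 := by
  obtain ⟨u, hum, hud, huU, huinj⟩ := exists_measurable_partition_injOn hF hF'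
  have hdet : Measurable fun x => (F' x).det :=
    (ContinuousLinearMap.continuous_det.comp hF').measurable
  refine ⟨fun i => u i.1 ∩ {x | SignType.sign (F' x).det = i.2},
    fun i => (hum i.1).inter (hdet (measurableSet_preimage_sign i.2)), ?_, ?_,
    fun i => (huinj i.1).mono inter_subset_left, fun i x hx => hx.2⟩
  · rintro ⟨n, ε⟩ ⟨m, δ⟩ hne
    refine disjoint_left.2 fun x ⟨hxn, hxε⟩ ⟨hxm, hxδ⟩ => hne (Prod.ext ?_ (hxε.symm.trans hxδ))
    by_contra hnm
    exact disjoint_left.1 (hud hnm) hxn hxm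
  · rw [← huU]
    ext x
    simp only [mem_iUnion, mem_inter_iff, mem_ofPred_eq, Prod.exists, exists_and_left,
      exists_eq', and_true]

theorem integral_det_smul_comp_of_injOn {μ : Measure E} [μ.IsAddHaarMeasure] {t : Set E}
    (hF : ∀ x, HasFDerivAt F (F' x) x) (ht : MeasurableSet t) (hinj : InjOn F t) {ε : SignType}
    (hsign : ∀ x ∈ t, SignType.sign (F' x).det = ε) {h : E → G} (hh : Integrable h μ) :
    Integrable (fun y => (F '' t).indicator (fun _ => (ε : ℝ)) y • h y) μ ∧
      IntegrableOn (fun x => (F' x).det • h (F x)) t μ ∧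
      ∫ x in t, (F' x).det • h (F x) ∂μ = ∫ y, (F '' t).indicator (fun _ => (ε : ℝ)) y • h y ∂μ ∧
      ∫ x in t, ‖(F' x).det • h (F x)‖ ∂μ =
        ∫ y, ‖(F '' t).indicator (fun _ => (ε : ℝ)) y • h y‖ ∂μ := by
  have hFt : ∀ x ∈ t, HasFDerivWithinAt F (F' x) t x := fun x _ => (hF x).hasFDerivWithinAt
  have himg : MeasurableSet (F '' t) := measurable_image_of_fderivWithin ht hFt hinj
  have hdet : ∀ x ∈ t, (F' x).det • h (F x) = |(F' x).det| • (ε : ℝ) • h (F x) := fun x hx => by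
    rw [smul_smul, ← hsign x hx, abs_mul_sign]
  have hnorm : ∀ x ∈ t, ‖(F' x).det • h (F x)‖ = |(F' x).det| • ‖(ε : ℝ) • h (F x)‖ :=
    fun x hx => by rw [hdet x hx, norm_smul, Real.norm_eq_abs, abs_abs, smul_eq_mul]
  have hind : ∀ y, (F '' t).indicator (fun _ => (ε : ℝ)) y • h y =
      (F '' t).indicator (fun y => (ε : ℝ) • h y) y := fun y =>
    (indicator_smul_apply_left _ (fun _ => (ε : ℝ)) h y).symm
  simp_rw [hind, norm_indicator_eq_indicator_norm]
  refine ⟨(hh.smul (ε : ℝ)).indicator himg, ?_, ?_, ?_⟩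
  · rw [integrableOn_congr_fun hdet ht]
    exact (integrableOn_image_iff_integrableOn_abs_det_fderiv_smul μ ht hFt hinj
      fun y => (ε : ℝ) • h y).1 (hh.smul (ε : ℝ)).integrableOn
  · rw [setIntegral_congr_fun ht hdet, integral_indicator himg,
      integral_image_eq_integral_abs_det_fderiv_smul μ ht hFt hinj]
  · rw [setIntegral_congr_fun ht hnorm, integral_indicator himg,
      integral_image_eq_integral_abs_det_fderiv_smul μ ht hFt hinj]

theorem hasSum_integral_smul_of_sum_abs_le {α ι : Type*} [MeasurableSpace α] {μ : Measure α}
    [Countable ι] [CompleteSpace G] {g : ι → α → ℝ} {K d : ℝ} {h : α → G}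
    (hh : Integrable h μ) (hgh : ∀ i, Integrable (fun y => g i y • h y) μ)
    (hsum : ∀ᵐ y ∂μ, HasSum (fun i => g i y) d)
    (hle : ∀ᵐ y ∂μ, ∀ s : Finset ι, ∑ i ∈ s, |g i y| ≤ K) :
    (∀ s : Finset ι, ∑ i ∈ s, ∫ y, ‖g i y • h y‖ ∂μ ≤ K * ∫ y, ‖h y‖ ∂μ) ∧
      HasSum (fun i => ∫ y, g i y • h y ∂μ) (d • ∫ y, h y ∂μ) := by
  have hbound : ∀ s : Finset ι, ∑ i ∈ s, ∫ y, ‖g i y • h y‖ ∂μ ≤ K * ∫ y, ‖h y‖ ∂μ := fun s => by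
    rw [← integral_finsetSum _ fun i _ => (hgh i).norm, ← integral_const_mul]
    refine integral_mono_ae (integrable_finsetSum _ fun i _ => (hgh i).norm)
      (hh.norm.const_mul K) ?_
    filter_upwards [hle] with y hy
    simp only [norm_smul, Real.norm_eq_abs, ← Finset.sum_mul]
    exact mul_le_mul_of_nonneg_right (hy s) (norm_nonneg _)
  refine ⟨hbound, ?_⟩
  convert hasSum_integral_of_summable_integral_norm hgh
    (summable_of_sum_le (fun i => integral_nonneg fun y => norm_nonneg _) hbound) using 1
  rw [← integral_smul]
  refine integral_congr_ae ?_
  filter_upwards [hsum] with y hy using (hy.smul_const (h y)).tsum_eq.symm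

-- The domain is cut into countably many pieces on which `F` is injective and the sign of its
-- Jacobian is constant, and the images of the pieces are summed fibre by fibre.
theorem integral_det_smul_comp_eq {μ : Measure E} [μ.IsAddHaarMeasure] [CompleteSpace G]
    (hF : ∀ x, HasFDerivAt F (F' x) x) (hF' : Continuous F') {K : ℕ} {d : ℝ}
    (hfib : ∀ᵐ y ∂μ, ∃ S : Finset E, (∀ x, x ∈ S ↔ F x = y) ∧ S.card ≤ K ∧
      ∑ x ∈ S, (SignType.sign (F' x).det : ℝ) = d) {h : E → G} (hh : Integrable h μ) :
    Integrable (fun x => (F' x).det • h (F x)) μ ∧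
      ∫ x, ‖(F' x).det • h (F x)‖ ∂μ ≤ K * ∫ y, ‖h y‖ ∂μ ∧
      ∫ x, (F' x).det • h (F x) ∂μ = d • ∫ y, h y ∂μ := by
  obtain ⟨t, htm, htd, htU, hinj, hsign⟩ := exists_measurable_partition_injOn_sign_det hF hF'
  have hzero : ∀ x, (∀ i, x ∉ t i) → (F' x).det = 0 := fun x hx => by
    by_contra hne
    obtain ⟨i, hi⟩ := mem_iUnion.1 (htU.superset hne)
    exact hx i hi
  have hsign_zero : ∀ x, (∀ i, x ∉ t i) → (SignType.sign (F' x).det : ℝ) = 0 := fun x hx => by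
    rw [hzero x hx, sign_zero, SignType.coe_zero]
  let g : ℕ × SignType → E → ℝ := fun i => (F '' t i).indicator fun _ => (i.2 : ℝ)
  have hsum : ∀ᵐ y ∂μ, HasSum (fun i => g i y) d := by
    filter_upwards [hfib] with y ⟨S, hS, _, hd⟩
    exact hd ▸ hasSum_indicator_image htd hinj (fun i x hx => by rw [hsign i x hx]) hsign_zero hS
  have hle : ∀ᵐ y ∂μ, ∀ s : Finset (ℕ × SignType), ∑ i ∈ s, |g i y| ≤ K := by
    filter_upwards [hfib] with y ⟨S, hS, hK, _⟩ s
    refine (sum_abs_indicator_image_le htd hinj (fun i x hx => by rw [hsign i x hx]) hsign_zero hS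
      s).trans ?_
    refine (Finset.sum_le_card_nsmul S _ 1 fun x _ => abs_coe_sign_le_one _).trans ?_
    rw [nsmul_one]
    exact_mod_cast hK
  have hpiece := fun i => integral_det_smul_comp_of_injOn hF (htm i) (hinj i) (hsign i) hh
  obtain ⟨hbound, hlim⟩ := hasSum_integral_smul_of_sum_abs_le hh (fun i => (hpiece i).1) hsum hle
  simp only [← (hpiece _).2.2.1, ← (hpiece _).2.2.2] at hbound hlim
  have hint : IntegrableOn (fun x => (F' x).det • h (F x)) (⋃ i, t i) μ :=
    integrableOn_iUnion_of_summable_integral_norm (fun i => (hpiece i).2.1)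
      (summable_of_sum_le (fun i => integral_nonneg fun x => norm_nonneg _) hbound)
  have hoff : ∀ x ∉ ⋃ i, t i, (F' x).det • h (F x) = 0 := fun x hx => by
    rw [hzero x fun i hi => hx (mem_iUnion.2 ⟨i, hi⟩), zero_smul]
  refine ⟨(integrableOn_iff_integrable_of_support_subset fun x hx => ?_).1 hint, ?_, ?_⟩
  · exact not_not.1 fun h => hx (hoff x h)
  · rw [← setIntegral_eq_integral_of_forall_compl_eq_zero fun x hx => by rw [hoff x hx, norm_zero]]
    exact hasSum_le_of_sum_le (hasSum_integral_iUnion htm htd hint.norm) hbound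
  · rw [← setIntegral_eq_integral_of_forall_compl_eq_zero hoff]
    exact (hasSum_integral_iUnion htm htd hint).unique hlim

end AreaFormula

section MonicPoly

open Polynomial Finset

variable {R : Type*} [DecidableEq R] {n m M : ℕ}

/-- The monic polynomial `X ^ n + ∑ b_i X ^ i` with lower coefficients `b`. -/
noncomputable def monicPoly [Semiring R] (b : Fin n → R) : R[X] := X ^ n + ofFn n b

theorem monic_monicPoly [Semiring R] (b : Fin n → R) : (monicPoly b).Monic :=
  monic_X_pow_add (ofFn_degree_lt b)

@[simp] theorem natDegree_monicPoly [Semiring R] [Nontrivial R] (b : Fin n → R) :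
    (monicPoly b).natDegree = n := by
  refine natDegree_eq_of_degree_eq_some ?_
  rw [monicPoly, degree_add_eq_left_of_degree_lt, degree_X_pow]
  exact (ofFn_degree_lt b).trans_eq (degree_X_pow n).symm

@[simp] theorem coeff_monicPoly_fin [Semiring R] (b : Fin n → R) (i : Fin n) :
    (monicPoly b).coeff i = b i := by
  rw [monicPoly, coeff_add, coeff_X_pow, if_neg i.2.ne, ofFn_coeff_eq_val_of_lt b i.2, zero_add]

theorem monicPoly_injective [Semiring R] :
    Function.Injective (monicPoly : (Fin n → R) → R[X]) := fun a b h => by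
  ext i
  rw [← coeff_monicPoly_fin a, h, coeff_monicPoly_fin]

theorem monicPoly_coeff [Semiring R] {p : R[X]} (hp : p.Monic) (hn : p.natDegree = n) :
    monicPoly (fun i : Fin n => p.coeff i) = p := by
  subst hn
  ext k
  rw [monicPoly, coeff_add, coeff_X_pow]
  rcases lt_trichotomy k p.natDegree with h | rfl | h
  · rw [if_neg h.ne, ofFn_coeff_eq_val_of_lt _ h, zero_add]
  · rw [if_pos rfl, ofFn_coeff_eq_zero_of_ge _ le_rfl, add_zero, hp.coeff_natDegree]
  · rw [if_neg h.ne', ofFn_coeff_eq_zero_of_ge _ h.le, zero_add, coeff_eq_zero_of_natDegree_lt h]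

variable [CommRing R]

/-- The monic polynomial of degree `m` whose lower coefficients are the first `m` entries of `x`. -/
noncomputable def headPoly (x : Fin (m + M) → R) : R[X] := monicPoly fun j => x (Fin.castAdd M j)

/-- The monic polynomial of degree `M` whose lower coefficients are the last `M` entries of `x`. -/
noncomputable def tailPoly (x : Fin (m + M) → R) : R[X] := monicPoly fun j => x (Fin.natAdd m j)

/-- Multiplication of monic polynomials of degrees `m` and `M`, on vectors of coefficients. -/
noncomputable def mulMap (m M : ℕ) (x : Fin (m + M) → R) (i : Fin (m + M)) : R :=
  (headPoly x * tailPoly x).coeff i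

theorem monicPoly_mulMap [Nontrivial R] (x : Fin (m + M) → R) :
    monicPoly (mulMap m M x) = headPoly x * tailPoly x := by
  refine monicPoly_coeff ((monic_monicPoly _).mul (monic_monicPoly _)) ?_
  rw [headPoly, tailPoly, (monic_monicPoly _).natDegree_mul (monic_monicPoly _),
    natDegree_monicPoly, natDegree_monicPoly]

theorem sylvester_mulVec {q g : R[X]} (hq : q.natDegree ≤ m) (hg : g.natDegree ≤ M)
    (v : Fin (m + M) → R) (i : Fin (m + M)) :
    (sylvester q g m M).mulVec v i = (q * ofFn M (fun j => v (Fin.natAdd m j)) +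
      ofFn m (fun j => v (Fin.castAdd M j)) * g).coeff i := by
  rw [Matrix.mulVec, dotProduct, Fin.sum_univ_add, coeff_add, add_comm]
  congr 1
  · rw [ofFn_eq_sum_monomial, Finset.mul_sum, finsetSum_coeff]
    refine sum_congr rfl fun j _ => ?_
    rw [← C_mul_X_pow_eq_monomial, mul_left_comm, coeff_C_mul, coeff_mul_X_pow', mul_comm]
    simp only [sylvester, Matrix.of_apply, Fin.addCases_right, Set.mem_Icc, ite_and]
    split_ifs with h1 h2 <;> try rfl
    rw [coeff_eq_zero_of_natDegree_lt (by omega)]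
  · rw [ofFn_eq_sum_monomial, Finset.sum_mul, finsetSum_coeff]
    refine sum_congr rfl fun j _ => ?_
    rw [← C_mul_X_pow_eq_monomial, mul_assoc, coeff_C_mul, coeff_X_pow_mul', mul_comm]
    simp only [sylvester, Matrix.of_apply, Fin.addCases_left, Set.mem_Icc, ite_and]
    split_ifs with h1 h2 <;> try rfl
    rw [coeff_eq_zero_of_natDegree_lt (by omega)]

/-- The derivative of `mulMap`, which is given by the Sylvester matrix of the two factors. -/
noncomputable def mulMapDeriv (m M : ℕ) (x : Fin (m + M) → ℝ) :
    (Fin (m + M) → ℝ) →L[ℝ] (Fin (m + M) → ℝ) :=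
  (Matrix.toLin' (sylvester (headPoly x) (tailPoly x) m M)).toContinuousLinearMap

theorem det_mulMapDeriv (x : Fin (m + M) → ℝ) :
    (mulMapDeriv m M x).det = resultant (headPoly x) (tailPoly x) := by
  rw [mulMapDeriv, LinearMap.det_toContinuousLinearMap, LinearMap.det_toLin', resultant, headPoly,
    tailPoly, natDegree_monicPoly, natDegree_monicPoly]

/-- The `k`-th coefficient of the polynomial with coefficient vector `v ∘ f`, as a functional
of `v`. -/
noncomputable def coeffOfFn {N : ℕ} (f : Fin n → Fin N) (k : ℕ) : (Fin N → ℝ) →L[ℝ] ℝ :=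
  (lcoeff ℝ k ∘ₗ ofFn n ∘ₗ LinearMap.funLeft ℝ ℝ f).toContinuousLinearMap

theorem hasFDerivAt_coeff_monicPoly {N : ℕ} (f : Fin n → Fin N) (k : ℕ) (x : Fin N → ℝ) :
    HasFDerivAt (fun x : Fin N → ℝ => (monicPoly fun j => x (f j)).coeff k) (coeffOfFn f k) x := by
  simp only [monicPoly, coeff_add]
  exact (coeffOfFn f k).hasFDerivAt.const_add _

theorem hasFDerivAt_mulMap (x : Fin (m + M) → ℝ) :
    HasFDerivAt (mulMap m M) (mulMapDeriv m M x) x := by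
  rw [hasFDerivAt_pi']
  intro i
  have hprod := HasFDerivAt.fun_sum (u := HasAntidiagonal.antidiagonal (i : ℕ)) fun k _ =>
    (hasFDerivAt_coeff_monicPoly (Fin.castAdd M) k.1 x).mul
      (hasFDerivAt_coeff_monicPoly (Fin.natAdd m) k.2 x)
  simp_rw [mulMap, coeff_mul]
  refine hprod.congr_fderiv (ContinuousLinearMap.ext fun v => ?_)
  have hsylv := sylvester_mulVec (q := headPoly x) (g := tailPoly x) (natDegree_monicPoly _).le
    (natDegree_monicPoly _).le v i
  rw [coeff_add, coeff_mul, coeff_mul, ← sum_add_distrib] at hsylv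
  rw [_root_.sum_apply]
  refine (sum_congr rfl fun k _ => ?_).trans hsylv.symm
  exact congrArg₂ _ rfl (mul_comm _ _)

theorem continuous_coeff_monicPoly (k : ℕ) :
    Continuous fun b : Fin n → ℝ => (monicPoly b).coeff k :=
  continuous_iff_continuousAt.2 fun b => (hasFDerivAt_coeff_monicPoly id k b).continuousAt

theorem continuous_sylvester {S X : Type*} [CommRing S] [TopologicalSpace S] [TopologicalSpace X]
    {q g : X → S[X]}
    (hq : ∀ k, Continuous fun x => (q x).coeff k) (hg : ∀ k, Continuous fun x => (g x).coeff k) :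
    Continuous fun x => sylvester (q x) (g x) m M := by
  refine continuous_matrix fun i j => ?_
  refine Fin.addCases (fun j => ?_) (fun j => ?_) j
  · simp only [sylvester, Matrix.of_apply, Fin.addCases_left]
    split_ifs
    exacts [hg _, continuous_const]
  · simp only [sylvester, Matrix.of_apply, Fin.addCases_right]
    split_ifs
    exacts [hq _, continuous_const]

theorem continuous_mulMapDeriv : Continuous (mulMapDeriv m M) := by
  have hsylv : Continuous fun x : Fin (m + M) → ℝ => sylvester (headPoly x) (tailPoly x) m M :=
    continuous_sylvester (fun k => (continuous_coeff_monicPoly k).comp (by fun_prop))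
      (fun k => (continuous_coeff_monicPoly k).comp (by fun_prop))
  exact (LinearMap.continuous_of_finiteDimensional (LinearMap.toContinuousLinearMap.toLinearMap ∘ₗ
    (Matrix.toLin' (R := ℝ) (m := Fin (m + M)) (n := Fin (m + M))).toLinearMap)).comp hsylv

end MonicPoly

section Separable

open Polynomial

variable {n m M : ℕ}

theorem exists_mul_eq_not_isCoprime_of_not_separable {K : Type*} [Field K] [PerfectField K]
    {f : K[X]} (hf : f.Monic) (hsep : ¬ f.Separable) :
    ∃ q g : K[X], q.Monic ∧ g.Monic ∧ q * g = f ∧ ¬ IsCoprime q g := by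
  classical
  rw [PerfectField.separable_iff_squarefree,
    squarefree_iff_irreducible_sq_not_dvd_of_ne_zero hf.ne_zero] at hsep
  push Not at hsep
  obtain ⟨p, hp, hdvd⟩ := hsep
  have hassoc : Associated (normalize p) p := normalize_associated p
  have hmonic : (normalize p).Monic := monic_normalize hp.ne_zero
  obtain ⟨r, rfl⟩ := (hassoc.mul_mul hassoc).dvd_iff_dvd_left.2 hdvd
  rw [mul_assoc] at hf
  refine ⟨normalize p, normalize p * r, hmonic, hmonic.of_mul_monic_left hf,
    (mul_assoc _ _ _).symm, fun hco => hp.not_isUnit (hassoc.isUnit_iff.1 ?_)⟩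
  exact hco.isUnit_of_dvd' dvd_rfl (dvd_mul_right _ _)

-- By Sard's theorem, since the Jacobian of the multiplication map at `(q, g)` is the resultant.
theorem ae_isCoprime_of_mul_eq (h : m + M = n) : ∀ᵐ b : Fin n → ℝ, ∀ q g : ℝ[X], q.Monic →
    g.Monic → q.natDegree = m → g.natDegree = M → q * g = monicPoly b → IsCoprime q g := by
  subst h
  have hsard := addHaar_image_eq_zero_of_det_fderivWithin_eq_zero
    (volume : Measure (Fin (m + M) → ℝ)) (s := {x | (mulMapDeriv m M x).det = 0})
    (fun x _ => (hasFDerivAt_mulMap x).hasFDerivWithinAt) (fun x hx => hx)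
  rw [ae_iff]
  refine measure_mono_null (fun b hb => ?_) hsard
  simp only [Set.mem_ofPred_eq, not_forall] at hb
  obtain ⟨q, g, hq, hg, hqm, hgM, hqg, hco⟩ := hb
  let x : Fin (m + M) → ℝ := Fin.addCases (fun j => q.coeff j) (fun j => g.coeff j)
  have hhead : headPoly x = q := by simpa [x, headPoly] using monicPoly_coeff hq hqm
  have htail : tailPoly x = g := by simpa [x, tailPoly] using monicPoly_coeff hg hgM
  refine ⟨x, ?_, monicPoly_injective (by rw [monicPoly_mulMap, hhead, htail, hqg])⟩
  rw [Set.mem_ofPred_eq, det_mulMapDeriv, hhead, htail, resultant_eq_zero_iff]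
  exact ⟨Or.inl hq.ne_zero, hco⟩

theorem ae_separable_monicPoly (n : ℕ) : ∀ᵐ b : Fin n → ℝ, (monicPoly b).Separable := by
  have hcoprime : ∀ᵐ b : Fin n → ℝ, ∀ m M : ℕ, m + M = n → ∀ q g : ℝ[X], q.Monic → g.Monic →
      q.natDegree = m → g.natDegree = M → q * g = monicPoly b → IsCoprime q g := by
    refine ae_all_iff.2 fun m => ae_all_iff.2 fun M => ?_
    exact Filter.eventually_imp_distrib_left.2 ae_isCoprime_of_mul_eq
  filter_upwards [hcoprime] with b hb
  by_contra hsep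
  obtain ⟨q, g, hq, hg, hqg, hco⟩ :=
    exists_mul_eq_not_isCoprime_of_not_separable (monic_monicPoly b) hsep
  refine hco (hb _ _ ?_ q g hq hg rfl rfl hqg)
  rw [← hq.natDegree_mul hg, hqg, natDegree_monicPoly]

end Separable

section RootPair

open Polynomial
open scoped ComplexConjugate

/-- The discriminant of the quadratic polynomial `x² + q₁ x + q₀`. -/
def quadDisc (q : Fin 2 → ℝ) : ℝ := q 1 ^ 2 - 4 * q 0

/-- A square root of the discriminant of `x² + q₁ x + q₀`, non-negative or on the upper imaginary
axis. -/
noncomputable def sqrtDisc (q : Fin 2 → ℝ) : ℂ :=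
  (√(quadDisc q) : ℂ) + (√(-quadDisc q) : ℂ) * Complex.I

/-- The first root of `x² + q₁ x + q₀`: the smaller real one, or the one in the lower half plane. -/
noncomputable def lowRoot (q : Fin 2 → ℝ) : ℂ := (-(q 1 : ℂ) - sqrtDisc q) / 2

/-- The second root of `x² + q₁ x + q₀`: the larger real one, or the one in the upper half plane. -/
noncomputable def highRoot (q : Fin 2 → ℝ) : ℂ := (-(q 1 : ℂ) + sqrtDisc q) / 2

/-- The coefficients of the real quadratic polynomial with roots `a` and `b`, where `a` and `b` are
real or conjugate to each other. -/
noncomputable def pairCoeff (a b : ℂ) : Fin 2 → ℝ := ![(a * b).re, -(a + b).re]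

theorem sqrtDisc_of_nonneg {q : Fin 2 → ℝ} (h : 0 ≤ quadDisc q) : sqrtDisc q = √(quadDisc q) := by
  rw [sqrtDisc, Real.sqrt_eq_zero_of_nonpos (neg_nonpos.2 h), Complex.ofReal_zero, zero_mul,
    add_zero]

theorem sqrtDisc_of_nonpos {q : Fin 2 → ℝ} (h : quadDisc q ≤ 0) :
    sqrtDisc q = √(-quadDisc q) * Complex.I := by
  rw [sqrtDisc, Real.sqrt_eq_zero_of_nonpos h, Complex.ofReal_zero, zero_add]

theorem sqrtDisc_sq (q : Fin 2 → ℝ) : sqrtDisc q ^ 2 = quadDisc q := by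
  rcases le_total 0 (quadDisc q) with h | h
  · rw [sqrtDisc_of_nonneg h, ← Complex.ofReal_pow, Real.sq_sqrt h]
  · rw [sqrtDisc_of_nonpos h, mul_pow, Complex.I_sq, ← Complex.ofReal_pow,
      Real.sq_sqrt (neg_nonneg.2 h), Complex.ofReal_neg, mul_neg_one, neg_neg]

theorem lowRoot_add_highRoot (q : Fin 2 → ℝ) : lowRoot q + highRoot q = -(q 1 : ℂ) := by
  rw [lowRoot, highRoot]; ring

theorem highRoot_sub_lowRoot (q : Fin 2 → ℝ) : highRoot q - lowRoot q = sqrtDisc q := by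
  rw [lowRoot, highRoot]; ring

theorem highRoot_sub_lowRoot_sq (q : Fin 2 → ℝ) : (highRoot q - lowRoot q) ^ 2 = quadDisc q := by
  rw [highRoot_sub_lowRoot, sqrtDisc_sq]

theorem lowRoot_mul_highRoot (q : Fin 2 → ℝ) : lowRoot q * highRoot q = q 0 := by
  have h := sqrtDisc_sq q
  rw [quadDisc] at h
  push_cast at h
  rw [lowRoot, highRoot]
  linear_combination -h / 4

theorem quadDisc_eq_zero_iff (q : Fin 2 → ℝ) : quadDisc q = 0 ↔ lowRoot q = highRoot q := by
  rw [← Complex.ofReal_eq_zero, ← highRoot_sub_lowRoot_sq, sq_eq_zero_iff, sub_eq_zero, eq_comm]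

theorem map_monicPoly_two (q : Fin 2 → ℝ) :
    (monicPoly q).map (algebraMap ℝ ℂ) = (X - C (lowRoot q)) * (X - C (highRoot q)) := by
  have hadd := congrArg C (lowRoot_add_highRoot q)
  have hmul := congrArg C (lowRoot_mul_highRoot q)
  simp only [C_add, C_mul, C_neg] at hadd hmul
  simp only [monicPoly, ofFn_eq_sum_monomial, ← C_mul_X_pow_eq_monomial, Fin.sum_univ_two,
    Polynomial.map_add, Polynomial.map_mul, Polynomial.map_pow, map_X, map_C, Fin.val_zero,
    Fin.val_one, Complex.coe_algebraMap]
  linear_combination X * hadd - hmul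

@[simp] theorem pairCoeff_lowRoot_highRoot (q : Fin 2 → ℝ) :
    pairCoeff (lowRoot q) (highRoot q) = q := by
  ext i
  fin_cases i
  · exact congrArg Complex.re (lowRoot_mul_highRoot q)
  · simp [pairCoeff, lowRoot_add_highRoot, -Complex.add_re]

theorem quadDisc_pairCoeff_ofReal (x y : ℝ) : quadDisc (pairCoeff x y) = (y - x) ^ 2 := by
  simp only [quadDisc, pairCoeff, ← Complex.ofReal_mul, ← Complex.ofReal_add, Complex.ofReal_re,
    Matrix.cons_val_zero, Matrix.cons_val_one]
  ring

theorem quadDisc_pairCoeff_conj (β : ℂ) : quadDisc (pairCoeff (conj β) β) = -(2 * β.im) ^ 2 := by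
  simp only [quadDisc, pairCoeff, Complex.mul_re, Complex.add_re, Complex.conj_re, Complex.conj_im,
    Matrix.cons_val_zero, Matrix.cons_val_one]
  ring

theorem roots_pairCoeff_ofReal {x y : ℝ} (h : x < y) :
    lowRoot (pairCoeff x y) = x ∧ highRoot (pairCoeff x y) = y := by
  have hsqrt : sqrtDisc (pairCoeff x y) = y - x := by
    rw [sqrtDisc_of_nonneg (by rw [quadDisc_pairCoeff_ofReal]; positivity),
      quadDisc_pairCoeff_ofReal, Real.sqrt_sq (sub_pos.2 h).le, Complex.ofReal_sub]
  have hone : (pairCoeff x y 1 : ℂ) = -(x + y) := by simp [pairCoeff]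
  constructor
  · rw [lowRoot, hsqrt, hone]; ring
  · rw [highRoot, hsqrt, hone]; ring

theorem roots_pairCoeff_conj {β : ℂ} (h : 0 < β.im) :
    lowRoot (pairCoeff (conj β) β) = conj β ∧ highRoot (pairCoeff (conj β) β) = β := by
  have hsqrt : sqrtDisc (pairCoeff (conj β) β) = β - conj β := by
    rw [sqrtDisc_of_nonpos (by rw [quadDisc_pairCoeff_conj, neg_nonpos]; positivity),
      quadDisc_pairCoeff_conj, neg_neg, Real.sqrt_sq (by positivity), Complex.sub_conj]
  have hone : (pairCoeff (conj β) β 1 : ℂ) = -(β + conj β) := by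
    simp [pairCoeff, Complex.add_conj, two_mul]
  constructor
  · rw [lowRoot, hsqrt, hone]; ring
  · rw [highRoot, hsqrt, hone]; ring

theorem exists_ofReal_roots_of_quadDisc_pos {q : Fin 2 → ℝ} (h : 0 < quadDisc q) :
    ∃ x y : ℝ, x < y ∧ lowRoot q = x ∧ highRoot q = y := by
  refine ⟨(-q 1 - √(quadDisc q)) / 2, (-q 1 + √(quadDisc q)) / 2, ?_, ?_, ?_⟩
  · linarith [Real.sqrt_pos.2 h]
  · rw [lowRoot, sqrtDisc_of_nonneg h.le]; push_cast; rfl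
  · rw [highRoot, sqrtDisc_of_nonneg h.le]; push_cast; rfl

theorem conj_roots_of_quadDisc_neg {q : Fin 2 → ℝ} (h : quadDisc q < 0) :
    0 < (highRoot q).im ∧ lowRoot q = conj (highRoot q) := by
  rw [highRoot, lowRoot, sqrtDisc_of_nonpos h.le]
  constructor
  · simpa using Real.sqrt_pos.2 (neg_pos.2 h)
  · rw [map_div₀, map_add, map_mul, map_neg, Complex.conj_I, Complex.conj_ofReal,
      Complex.conj_ofReal, map_ofNat, mul_neg, sub_eq_add_neg]

theorem aeval_ofReal (f : ℝ[X]) (x : ℝ) : aeval (x : ℂ) f = (f.eval x : ℝ) := by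
  rw [← Complex.coe_algebraMap, aeval_algebraMap_apply, coe_aeval_eq_eval]

theorem ofReal_resultant_monicPoly_two (q : Fin 2 → ℝ) (g : ℝ[X]) :
    ((resultant (monicPoly q) g : ℝ) : ℂ) = aeval (lowRoot q) g * aeval (highRoot q) g := by
  have hmap := resultant_map_map (monicPoly q) g (monicPoly q).natDegree g.natDegree
    (algebraMap ℝ ℂ)
  have heval := resultant_eq_prod_eval ((monicPoly q).map (algebraMap ℝ ℂ))
    (g.map (algebraMap ℝ ℂ)) g.natDegree natDegree_map_le (IsAlgClosed.splits _)
  rw [natDegree_map, hmap, ((monic_monicPoly q).map _).leadingCoeff, map_monicPoly_two,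
    roots_mul (mul_ne_zero (X_sub_C_ne_zero _) (X_sub_C_ne_zero _)), roots_X_sub_C,
    roots_X_sub_C] at heval
  simpa using heval

theorem aeval_derivative_mul_aeval_derivative (q : Fin 2 → ℝ) (g : ℝ[X]) :
    aeval (lowRoot q) (derivative (monicPoly q * g)) *
        aeval (highRoot q) (derivative (monicPoly q * g)) =
      ((-(quadDisc q * resultant (monicPoly q) g) : ℝ) : ℂ) := by
  push_cast
  rw [ofReal_resultant_monicPoly_two, ← highRoot_sub_lowRoot_sq]
  simp only [← eval_map_algebraMap, Polynomial.map_mul, map_monicPoly_two, ← derivative_map]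
  simp only [derivative_mul, derivative_X_sub_C, eval_add, eval_mul, eval_sub, eval_X, eval_C,
    eval_one]
  ring

end RootPair

section SignedCount

open Polynomial Finset
open scoped ComplexConjugate

theorem sum_sign_prod_sub (A : Finset ℝ) :
    ∑ a ∈ A, (SignType.sign (∏ b ∈ A.erase a, (a - b)) : ℝ) = (#A % 2 : ℕ) := by
  induction A using Finset.induction_on_max with
  | empty => simp
  | insert m s hm ih =>
    have hms : m ∉ s := fun h => lt_irrefl _ (hm m h)
    have hflip : ∀ a ∈ s, (SignType.sign (∏ b ∈ (insert m s).erase a, (a - b)) : ℝ) =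
        -(SignType.sign (∏ b ∈ s.erase a, (a - b)) : ℝ) := fun a ha => by
      rw [erase_insert_of_ne (hm a ha).ne', prod_insert fun h => hms (mem_of_mem_erase h),
        sign_mul, sign_neg (sub_neg.2 (hm a ha)), neg_one_mul, SignType.coe_neg]
    rw [sum_insert hms, erase_insert hms, card_insert_of_notMem hms,
      sign_pos (prod_pos fun b hb => sub_pos.2 (hm b hb)), sum_congr rfl hflip, sum_neg_distrib,
      ih]
    rcases Nat.mod_two_eq_zero_or_one #s with h | h
    · simp [h, Nat.add_mod]
    · simp [h, Nat.add_mod]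

theorem two_mul_sum_filter_lt_mul (A : Finset ℝ) (ε : ℝ → ℝ) :
    2 * ∑ p ∈ A ×ˢ A with p.1 < p.2, ε p.1 * ε p.2 = (∑ a ∈ A, ε a) ^ 2 - ∑ a ∈ A, ε a ^ 2 := by
  simp only [sum_filter, sum_product]
  induction A using Finset.induction_on_max with
  | empty => simp
  | insert m s hm ih =>
    have hms : m ∉ s := fun h => lt_irrefl _ (hm m h)
    have hlast : ∑ b ∈ s, (if m < b then ε m * ε b else 0) = 0 :=
      sum_eq_zero fun b hb => if_neg (hm b hb).not_gt
    have hcol : ∑ a ∈ s, (if a < m then ε a * ε m else 0) = (∑ a ∈ s, ε a) * ε m := by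
      rw [sum_mul]
      exact sum_congr rfl fun a ha => if_pos (hm a ha)
    simp only [sum_insert hms, lt_self_iff_false, if_false, hlast, sum_add_distrib, hcol]
    linear_combination ih

theorem eval_pos_of_roots_eq_zero {h : ℝ[X]} (hm : h.Monic) (hr : h.roots = 0) (x : ℝ) :
    0 < h.eval x := by
  by_contra! hx
  rcases Nat.eq_zero_or_pos h.natDegree with hdeg | hdeg
  · rw [eq_one_of_monic_natDegree_zero hm hdeg, eval_one] at hx
    exact hx.not_gt one_pos
  · have htop := h.tendsto_atTop_of_leadingCoeff_nonneg (natDegree_pos_iff_degree_pos.1 hdeg)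
      (hm.leadingCoeff ▸ zero_le_one)
    obtain ⟨y, hy, hxy⟩ :=
      ((htop.eventually_ge_atTop 0).and (Filter.eventually_ge_atTop x)).exists
    obtain ⟨z, -, hz⟩ := intermediate_value_Icc hxy h.continuous.continuousOn ⟨hx, hy⟩
    exact Multiset.eq_zero_iff_forall_notMem.1 hr z ((mem_roots hm.ne_zero).2 hz)

theorem sum_sign_eval_derivative {f : ℝ[X]} (hf : f.Monic) (hs : f.Separable) :
    ∑ a ∈ f.roots.toFinset, (SignType.sign (f.derivative.eval a) : ℝ) =
      (#f.roots.toFinset % 2 : ℕ) := by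
  obtain ⟨h, hfh, -, hr⟩ := exists_prod_multiset_X_sub_C_mul f
  have hprod : (f.roots.map fun a => X - C a).prod = ∏ a ∈ f.roots.toFinset, (X - C a) := by
    rw [prod_eq_multiset_prod, Multiset.toFinset_val, (nodup_roots hs).dedup]
  rw [hprod] at hfh
  have hm : h.Monic := (monic_prod_X_sub_C _ _).of_mul_monic_left (hfh.symm ▸ hf)
  rw [← sum_sign_prod_sub]
  refine sum_congr rfl fun a ha => ?_
  have hderiv : f.derivative.eval a = (∏ b ∈ f.roots.toFinset.erase a, (a - b)) * h.eval a := by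
    conv_lhs => rw [← hfh, ← mul_prod_erase _ _ ha]
    simp [derivative_mul, eval_prod]
  rw [hderiv, sign_mul, sign_pos (eval_pos_of_roots_eq_zero hm hr a), mul_one]

/-- The roots of a real polynomial in the upper half plane. -/
noncomputable def upperRoots (f : ℝ[X]) : Finset ℂ := {z ∈ (f.aroots ℂ).toFinset | 0 < z.im}

theorem mem_upperRoots {f : ℝ[X]} (hf : f ≠ 0) {z : ℂ} :
    z ∈ upperRoots f ↔ aeval z f = 0 ∧ 0 < z.im := by
  rw [upperRoots, mem_filter, Multiset.mem_toFinset, mem_aroots, and_iff_right hf]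

theorem card_filter_im_eq_zero {f : ℝ[X]} (hf : f ≠ 0) :
    #{z ∈ (f.aroots ℂ).toFinset | z.im = 0} = #f.roots.toFinset := by
  refine (card_nbij' Complex.ofReal Complex.re ?_ ?_ ?_ ?_).symm
  · intro a ha
    simpa [hf, aeval_ofReal] using ha
  · intro z hz
    simp only [coe_filter, Multiset.mem_toFinset, mem_aroots, Set.mem_ofPred_eq] at hz
    have hre : (z.re : ℂ) = z := Complex.ext rfl hz.2.symm
    rw [← hre, aeval_ofReal, Complex.ofReal_eq_zero] at hz
    simpa [hf] using hz.1.2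
  · exact fun a _ => Complex.ofReal_re a
  · exact fun z hz => Complex.ext rfl (mem_filter.1 hz).2.symm

theorem card_filter_im_neg {f : ℝ[X]} (hf : f ≠ 0) :
    #{z ∈ (f.aroots ℂ).toFinset | z.im < 0} = #(upperRoots f) := by
  refine card_nbij' (starRingEnd ℂ) (starRingEnd ℂ) ?_ ?_ ?_ ?_
  · intro z hz
    simpa [mem_upperRoots hf, aeval_conj, hf] using hz
  · intro z hz
    simpa [mem_upperRoots hf, aeval_conj, hf] using hz
  · exact fun z _ => Complex.conj_conj z
  · exact fun z _ => Complex.conj_conj z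

theorem card_roots_add_two_mul_card_upperRoots {f : ℝ[X]} (hs : f.Separable) :
    #f.roots.toFinset + 2 * #(upperRoots f) = f.natDegree := by
  have hcard : #(f.aroots ℂ).toFinset = f.natDegree := by
    rw [Multiset.toFinset_card_of_nodup (nodup_roots hs.map), IsAlgClosed.card_aroots_eq_natDegree]
  have hpos := card_filter_add_card_filter_not (s := (f.aroots ℂ).toFinset) fun z => 0 < z.im
  have hneg := card_filter_add_card_filter_not (s := {z ∈ (f.aroots ℂ).toFinset | ¬0 < z.im})
    fun z => z.im < 0
  have hzero : ∀ t : ℝ, ¬0 < t ∧ ¬t < 0 ↔ t = 0 := fun t => by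
    rw [not_lt, not_lt, le_antisymm_iff]
  simp only [filter_filter, hzero, and_iff_right_of_imp (lt_asymm (a := (_ : ℝ)) (b := 0))] at hneg
  have himneg := card_filter_im_neg hs.ne_zero
  have himzero := card_filter_im_eq_zero hs.ne_zero
  rw [upperRoots] at himneg ⊢
  omega

end SignedCount

section Fibre

open Polynomial Finset
open scoped ComplexConjugate

variable {M : ℕ}

/-- The pairs `(a, b)` of roots of `f` which are real with `a < b`, or conjugate with `b` in the
upper half plane: one pair for each real monic quadratic divisor of `f` with distinct roots. -/
noncomputable def rootPairs (f : ℝ[X]) : Finset (ℂ × ℂ) :=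
  {p ∈ f.roots.toFinset ×ˢ f.roots.toFinset | p.1 < p.2}.image
      (fun p => ((p.1 : ℂ), (p.2 : ℂ))) ∪
    (upperRoots f).image fun β => (conj β, β)

theorem mem_rootPairs {f : ℝ[X]} (hf : f ≠ 0) {p : ℂ × ℂ} : p ∈ rootPairs f ↔
    (∃ x y : ℝ, x < y ∧ f.eval x = 0 ∧ f.eval y = 0 ∧ p = (↑x, ↑y)) ∨
      ∃ β : ℂ, 0 < β.im ∧ aeval β f = 0 ∧ p = (conj β, β) := by
  simp only [rootPairs, mem_union, mem_image, mem_filter, mem_product, Multiset.mem_toFinset,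
    mem_roots hf, IsRoot.def, mem_upperRoots hf, Prod.exists]
  constructor
  · rintro (⟨x, y, ⟨⟨hx, hy⟩, hxy⟩, rfl⟩ | ⟨β, ⟨hβ, him⟩, rfl⟩)
    · exact Or.inl ⟨x, y, hxy, hx, hy, rfl⟩
    · exact Or.inr ⟨β, him, hβ, rfl⟩
  · rintro (⟨x, y, hxy, hx, hy, rfl⟩ | ⟨β, him, hβ, rfl⟩)
    · exact Or.inl ⟨x, y, ⟨⟨hx, hy⟩, hxy⟩, rfl⟩
    · exact Or.inr ⟨β, ⟨hβ, him⟩, rfl⟩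

theorem sum_rootPairs {f : ℝ[X]} (hf : f ≠ 0) (u : ℂ × ℂ → ℝ) :
    ∑ p ∈ rootPairs f, u p =
      ∑ p ∈ f.roots.toFinset ×ˢ f.roots.toFinset with p.1 < p.2, u ((p.1 : ℂ), (p.2 : ℂ)) +
        ∑ β ∈ upperRoots f, u (conj β, β) := by
  rw [rootPairs, sum_union, sum_image, sum_image]
  · exact fun β _ γ _ h => congrArg Prod.snd h
  · rintro ⟨x, y⟩ _ ⟨x', y'⟩ _ h
    simpa using h
  · rw [disjoint_left]
    rintro _ hreal hconj
    obtain ⟨p, -, rfl⟩ := mem_image.1 hreal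
    obtain ⟨β, hβ, h⟩ := mem_image.1 hconj
    have him := ((mem_upperRoots hf).1 hβ).2
    rw [show β = p.2 from congrArg Prod.snd h, Complex.ofReal_im] at him
    exact lt_irrefl _ him

theorem card_rootPairs_le (f : ℝ[X]) :
    #(rootPairs f) ≤ #f.roots.toFinset * #f.roots.toFinset + #(upperRoots f) :=
  (card_union_le _ _).trans <| Nat.add_le_add
    (card_image_le.trans <| (card_filter_le _ _).trans (card_product _ _).le) card_image_le

theorem roots_pairCoeff_of_mem {f : ℝ[X]} (hf : f ≠ 0) {p : ℂ × ℂ} (hp : p ∈ rootPairs f) :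
    lowRoot (pairCoeff p.1 p.2) = p.1 ∧ highRoot (pairCoeff p.1 p.2) = p.2 := by
  rcases (mem_rootPairs hf).1 hp with ⟨x, y, hxy, -, -, rfl⟩ | ⟨β, hβ, -, rfl⟩
  · exact roots_pairCoeff_ofReal hxy
  · exact roots_pairCoeff_conj hβ

theorem monicPoly_pairCoeff_dvd {f : ℝ[X]} (hf : f ≠ 0) {p : ℂ × ℂ} (hp : p ∈ rootPairs f) :
    monicPoly (pairCoeff p.1 p.2) ∣ f := by
  have hdvd : ∀ z : ℂ, aeval z f = 0 → X - C z ∣ f.map (algebraMap ℝ ℂ) := fun z hz =>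
    dvd_iff_isRoot.2 (by rwa [IsRoot.def, eval_map_algebraMap])
  rw [← map_dvd_map' (algebraMap ℝ ℂ), map_monicPoly_two, (roots_pairCoeff_of_mem hf hp).1,
    (roots_pairCoeff_of_mem hf hp).2]
  rcases (mem_rootPairs hf).1 hp with ⟨x, y, hxy, hx, hy, rfl⟩ | ⟨β, hβ, hroot, rfl⟩
  · refine (isCoprime_X_sub_C_of_isUnit_sub (sub_ne_zero.2 ?_).isUnit).mul_dvd
      (hdvd _ (by rw [aeval_ofReal, hx, Complex.ofReal_zero]))
      (hdvd _ (by rw [aeval_ofReal, hy, Complex.ofReal_zero]))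
    exact Complex.ofReal_injective.ne hxy.ne
  · refine (isCoprime_X_sub_C_of_isUnit_sub (sub_ne_zero.2 ?_).isUnit).mul_dvd
      (hdvd _ (by rw [aeval_conj, hroot, map_zero])) (hdvd _ hroot)
    exact fun h => hβ.ne' (Complex.conj_eq_iff_im.1 h)

/-- The coefficients of the factorisation of `f` whose quadratic factor has the pair of roots `p`
and whose other factor has degree `M`. -/
noncomputable def factorOfPair (f : ℝ[X]) (M : ℕ) (p : ℂ × ℂ) : Fin (2 + M) → ℝ :=
  Fin.addCases (pairCoeff p.1 p.2) fun j => (f /ₘ monicPoly (pairCoeff p.1 p.2)).coeff j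

@[simp] theorem headPoly_factorOfPair (f : ℝ[X]) (p : ℂ × ℂ) :
    headPoly (factorOfPair f M p) = monicPoly (pairCoeff p.1 p.2) := by
  simp only [headPoly, factorOfPair, Fin.addCases_left]

theorem mulMap_factorOfPair {y : Fin (2 + M) → ℝ} {p : ℂ × ℂ}
    (hp : p ∈ rootPairs (monicPoly y)) :
    mulMap 2 M (factorOfPair (monicPoly y) M p) = y := by
  obtain ⟨g, hg⟩ := monicPoly_pairCoeff_dvd (monic_monicPoly y).ne_zero hp
  have hq := monic_monicPoly (pairCoeff p.1 p.2)
  have hmonic : g.Monic := hq.of_mul_monic_left (hg ▸ monic_monicPoly y)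
  have hdeg : g.natDegree = M := by
    have h := congrArg natDegree hg
    rw [hq.natDegree_mul hmonic, natDegree_monicPoly, natDegree_monicPoly] at h
    omega
  apply monicPoly_injective
  rw [monicPoly_mulMap, headPoly_factorOfPair]
  simp only [tailPoly, factorOfPair, Fin.addCases_right]
  rw [hg, mul_divByMonic_cancel_left _ hq, monicPoly_coeff hmonic hdeg]

theorem factorOfPair_injOn {f : ℝ[X]} (hf : f ≠ 0) :
    Set.InjOn (factorOfPair f M) (rootPairs f) := by
  intro p hp p' hp' h
  have hq : pairCoeff p.1 p.2 = pairCoeff p'.1 p'.2 := by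
    apply monicPoly_injective
    rw [← headPoly_factorOfPair (M := M) f, h, headPoly_factorOfPair]
  obtain ⟨hlow, hhigh⟩ := roots_pairCoeff_of_mem hf hp
  obtain ⟨hlow', hhigh'⟩ := roots_pairCoeff_of_mem hf hp'
  exact Prod.ext (by rw [← hlow, hq, hlow']) (by rw [← hhigh, hq, hhigh'])

theorem roots_mem_rootPairs {q : Fin 2 → ℝ} {f : ℝ[X]} (hs : f.Separable)
    (hdvd : monicPoly q ∣ f) : (lowRoot q, highRoot q) ∈ rootPairs f := by
  have hmap : (X - C (lowRoot q)) * (X - C (highRoot q)) ∣ f.map (algebraMap ℝ ℂ) := by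
    rw [← map_monicPoly_two]
    exact Polynomial.map_dvd _ hdvd
  have hne : lowRoot q ≠ highRoot q := fun h =>
    (irreducible_X_sub_C _).not_isUnit (hs.map.squarefree _ (h ▸ hmap))
  have hlow : aeval (lowRoot q) f = 0 := by
    rw [← eval_map_algebraMap]
    exact dvd_iff_isRoot.1 ((dvd_mul_right _ _).trans hmap)
  have hhigh : aeval (highRoot q) f = 0 := by
    rw [← eval_map_algebraMap]
    exact dvd_iff_isRoot.1 ((dvd_mul_left _ _).trans hmap)
  rw [mem_rootPairs hs.ne_zero]
  rcases lt_trichotomy (quadDisc q) 0 with h | h | h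
  · obtain ⟨him, hconj⟩ := conj_roots_of_quadDisc_neg h
    exact Or.inr ⟨_, him, hhigh, by rw [hconj]⟩
  · exact absurd ((quadDisc_eq_zero_iff q).1 h) hne
  · obtain ⟨a, b, hab, ha, hb⟩ := exists_ofReal_roots_of_quadDisc_pos h
    rw [ha, aeval_ofReal, Complex.ofReal_eq_zero] at hlow
    rw [hb, aeval_ofReal, Complex.ofReal_eq_zero] at hhigh
    exact Or.inl ⟨a, b, hab, hlow, hhigh, by rw [ha, hb]⟩

theorem factorOfPair_roots (x : Fin (2 + M) → ℝ) :
    factorOfPair (monicPoly (mulMap 2 M x)) M (lowRoot fun j => x (Fin.castAdd M j),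
      highRoot fun j => x (Fin.castAdd M j)) = x := by
  ext i
  refine Fin.addCases (fun j => ?_) (fun j => ?_) i
  · simp [factorOfPair]
  · simp only [factorOfPair, Fin.addCases_right, pairCoeff_lowRoot_highRoot]
    rw [monicPoly_mulMap, headPoly, mul_divByMonic_cancel_left _ (monic_monicPoly _), tailPoly,
      coeff_monicPoly_fin]

theorem mem_image_factorOfPair_iff {y x : Fin (2 + M) → ℝ} (hs : (monicPoly y).Separable) :
    x ∈ (rootPairs (monicPoly y)).image (factorOfPair (monicPoly y) M) ↔ mulMap 2 M x = y := by
  rw [mem_image]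
  constructor
  · rintro ⟨p, hp, rfl⟩
    exact mulMap_factorOfPair hp
  · rintro rfl
    exact ⟨_, roots_mem_rootPairs hs (Dvd.intro _ (monicPoly_mulMap x).symm), factorOfPair_roots x⟩

theorem aeval_derivative_ne_zero {f : ℝ[X]} (hs : f.Separable) {z : ℂ} (hz : aeval z f = 0) :
    aeval z (derivative f) ≠ 0 := fun h => by
  obtain ⟨u, v, huv⟩ := hs
  simpa [hz, h] using congrArg (aeval z) huv

theorem sum_sign_eval_derivative_mul {f : ℝ[X]} (hf : f.Monic) (hs : f.Separable) :
    ∑ p ∈ f.roots.toFinset ×ˢ f.roots.toFinset with p.1 < p.2,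
      ((SignType.sign (f.derivative.eval p.1) : ℝ) * SignType.sign (f.derivative.eval p.2)) =
        -(#f.roots.toFinset / 2 : ℕ) := by
  have hsq : ∀ a ∈ f.roots.toFinset, (SignType.sign (f.derivative.eval a) : ℝ) ^ 2 = 1 :=
    fun a ha => by
      have hroot : aeval (a : ℂ) f = 0 := by simpa [hf.ne_zero, aeval_ofReal] using ha
      have hne := aeval_derivative_ne_zero hs hroot
      rw [aeval_ofReal, Complex.ofReal_ne_zero] at hne
      rcases hne.lt_or_gt with h | h <;> simp [h]
  have hpairs := two_mul_sum_filter_lt_mul f.roots.toFinset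
    fun a => (SignType.sign (f.derivative.eval a) : ℝ)
  rw [sum_congr rfl hsq, sum_const, nsmul_one, sum_sign_eval_derivative hf hs] at hpairs
  have hdiv : ((#f.roots.toFinset % 2 : ℕ) : ℝ) + 2 * (#f.roots.toFinset / 2 : ℕ) =
      #f.roots.toFinset := by exact_mod_cast Nat.mod_add_div _ 2
  have hmod : ((#f.roots.toFinset % 2 : ℕ) : ℝ) ^ 2 = (#f.roots.toFinset % 2 : ℕ) := by
    rcases Nat.mod_two_eq_zero_or_one #f.roots.toFinset with h | h <;> simp [h]
  linarith

theorem aeval_derivative_mul_of_mem_rootPairs {y : Fin (2 + M) → ℝ} {p : ℂ × ℂ}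
    (hp : p ∈ rootPairs (monicPoly y)) :
    aeval p.1 (derivative (monicPoly y)) * aeval p.2 (derivative (monicPoly y)) =
      ((-(quadDisc (pairCoeff p.1 p.2) *
        (mulMapDeriv 2 M (factorOfPair (monicPoly y) M p)).det) : ℝ) : ℂ) := by
  obtain ⟨hlow, hhigh⟩ := roots_pairCoeff_of_mem (monic_monicPoly y).ne_zero hp
  have hfactor : monicPoly (pairCoeff p.1 p.2) * tailPoly (factorOfPair (monicPoly y) M p) =
      monicPoly y := by
    rw [← headPoly_factorOfPair (M := M) (monicPoly y), ← monicPoly_mulMap, mulMap_factorOfPair hp]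
  have h := aeval_derivative_mul_aeval_derivative (pairCoeff p.1 p.2)
    (tailPoly (factorOfPair (monicPoly y) M p))
  rwa [hfactor, hlow, hhigh, ← headPoly_factorOfPair (M := M) (monicPoly y),
    ← det_mulMapDeriv] at h

theorem sign_det_mulMapDeriv_real {y : Fin (2 + M) → ℝ} {a b : ℝ} (hab : a < b)
    (hp : ((a : ℂ), (b : ℂ)) ∈ rootPairs (monicPoly y)) :
    SignType.sign (mulMapDeriv 2 M (factorOfPair (monicPoly y) M (a, b))).det =
      -(SignType.sign ((monicPoly y).derivative.eval a) *
        SignType.sign ((monicPoly y).derivative.eval b)) := by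
  have h := aeval_derivative_mul_of_mem_rootPairs hp
  rw [aeval_ofReal, aeval_ofReal, ← Complex.ofReal_mul, Complex.ofReal_inj,
    quadDisc_pairCoeff_ofReal] at h
  rw [← sign_mul, h, Left.sign_neg, neg_neg, sign_mul,
    sign_pos (pow_pos (sub_pos.2 hab) 2), one_mul]

theorem sign_det_mulMapDeriv_conj {y : Fin (2 + M) → ℝ} (hs : (monicPoly y).Separable) {β : ℂ}
    (him : 0 < β.im) (hroot : aeval β (monicPoly y) = 0)
    (hp : (conj β, β) ∈ rootPairs (monicPoly y)) :
    SignType.sign (mulMapDeriv 2 M (factorOfPair (monicPoly y) M (conj β, β))).det = 1 := by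
  have h := aeval_derivative_mul_of_mem_rootPairs hp
  rw [aeval_conj, ← Complex.normSq_eq_conj_mul_self, Complex.ofReal_inj, quadDisc_pairCoeff_conj,
    neg_mul, neg_neg] at h
  rw [sign_eq_one_iff]
  exact pos_of_mul_pos_right (h ▸ Complex.normSq_pos.2 (aeval_derivative_ne_zero hs hroot))
    (by positivity)

theorem sum_sign_det_mulMapDeriv {y : Fin (2 + M) → ℝ} (hs : (monicPoly y).Separable) :
    ∑ p ∈ rootPairs (monicPoly y),
      (SignType.sign (mulMapDeriv 2 M (factorOfPair (monicPoly y) M p)).det : ℝ) =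
        ((2 + M) / 2 : ℕ) := by
  have hf := (monic_monicPoly y).ne_zero
  have hreal : ∀ p ∈ {p ∈ (monicPoly y).roots.toFinset ×ˢ (monicPoly y).roots.toFinset | p.1 < p.2},
      (SignType.sign (mulMapDeriv 2 M (factorOfPair (monicPoly y) M ((p.1 : ℂ), (p.2 : ℂ)))).det :
        ℝ) = -(SignType.sign ((monicPoly y).derivative.eval p.1) *
          SignType.sign ((monicPoly y).derivative.eval p.2)) := fun p hp => by
    rw [sign_det_mulMapDeriv_real (mem_filter.1 hp).2
      (mem_union_left _ (mem_image_of_mem _ hp)), SignType.coe_neg, SignType.coe_mul]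
  have hconj : ∀ β ∈ upperRoots (monicPoly y),
      (SignType.sign (mulMapDeriv 2 M (factorOfPair (monicPoly y) M (conj β, β))).det : ℝ) = 1 :=
    fun β hβ => by
      rw [sign_det_mulMapDeriv_conj hs ((mem_upperRoots hf).1 hβ).2 ((mem_upperRoots hf).1 hβ).1
        (mem_union_right _ (mem_image_of_mem _ hβ)), SignType.coe_one]
  have hcount := card_roots_add_two_mul_card_upperRoots hs
  rw [natDegree_monicPoly] at hcount
  rw [sum_rootPairs hf, sum_congr rfl hreal, sum_congr rfl hconj, sum_neg_distrib,
    sum_sign_eval_derivative_mul (monic_monicPoly y) hs, neg_neg, sum_const, nsmul_one,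
    ← Nat.cast_add, Nat.cast_inj]
  omega

theorem exists_fibre_mulMap {y : Fin (2 + M) → ℝ} (hs : (monicPoly y).Separable) :
    ∃ S : Finset (Fin (2 + M) → ℝ), (∀ x, x ∈ S ↔ mulMap 2 M x = y) ∧
      #S ≤ (2 + M) * (3 + M) ∧
      ∑ x ∈ S, (SignType.sign (mulMapDeriv 2 M x).det : ℝ) = ((2 + M) / 2 : ℕ) := by
  have hcount := card_roots_add_two_mul_card_upperRoots hs
  rw [natDegree_monicPoly] at hcount
  refine ⟨(rootPairs (monicPoly y)).image (factorOfPair (monicPoly y) M),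
    fun x => mem_image_factorOfPair_iff hs, ?_, ?_⟩
  · refine card_image_le.trans <| (card_rootPairs_le _).trans ?_
    rw [show (2 + M) * (3 + M) = (2 + M) * (2 + M) + (2 + M) by ring]
    exact Nat.add_le_add (Nat.mul_le_mul (by omega) (by omega)) (by omega)
  · rw [sum_image (factorOfPair_injOn (monic_monicPoly y).ne_zero), sum_sign_det_mulMapDeriv hs]

end Fibre

section TransfersIntegral

variable {α β γ V : Type*} [MeasureSpace α] [MeasureSpace β] [MeasureSpace γ]
  [NormedAddCommGroup V] [NormedSpace ℝ V]

/-- The integral of `f` is `c` times that of `g`, and its `L¹` norm at most `K` times that of `g`.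
The bound is what makes iterated integrals of such `f` absolutely convergent. -/
structure TransfersIntegral (K c : ℝ) (f : α → V) (g : β → V) : Prop where
  integrable : Integrable f
  integral_norm_le : ∫ x, ‖f x‖ ≤ K * ∫ y, ‖g y‖
  integral_eq : ∫ x, f x = c • ∫ y, g y

theorem transfersIntegral_comp {φ : α → β} (hφ : MeasurePreserving φ) {g : β → V}
    (hg : Integrable g) : TransfersIntegral 1 1 (fun x => g (φ x)) g := by
  have hmap : Integrable g (Measure.map φ volume) := hφ.map_eq.symm ▸ hg
  refine ⟨hφ.integrable_comp_of_integrable hg, ?_, ?_⟩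
  · rw [one_mul, ← hφ.map_eq,
      integral_map hφ.measurable.aemeasurable hmap.norm.aestronglyMeasurable]
  · rw [one_smul, ← hφ.map_eq,
      integral_map hφ.measurable.aemeasurable hmap.aestronglyMeasurable]

theorem TransfersIntegral.trans {K c K' c' : ℝ} {f : α → V} {g : β → V} {h : γ → V}
    (hK : 0 ≤ K) (hfg : TransfersIntegral K c f g) (hgh : TransfersIntegral K' c' g h) :
    TransfersIntegral (K * K') (c * c') f h := by
  refine ⟨hfg.integrable, ?_, ?_⟩
  · rw [mul_assoc]
    exact hfg.integral_norm_le.trans (mul_le_mul_of_nonneg_left hgh.integral_norm_le hK)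
  · rw [hfg.integral_eq, hgh.integral_eq, smul_smul]

theorem TransfersIntegral.comp {K c : ℝ} {f : α → V} {g : β → V}
    (h : TransfersIntegral K c f g) {φ : γ → α} (hφ : MeasurePreserving φ) :
    TransfersIntegral K c (fun x => f (φ x)) g := by
  have htrans := (transfersIntegral_comp hφ h.integrable).trans zero_le_one h
  rwa [one_mul, one_mul] at htrans

theorem TransfersIntegral.prod [SFinite (volume : Measure α)] [SFinite (volume : Measure β)]
    [SFinite (volume : Measure γ)] {K c : ℝ} {f : α × β → V} {g : α × γ → V}
    (hf : AEStronglyMeasurable f) (hg : Integrable g)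
    (h : ∀ᵐ a : α, TransfersIntegral K c (fun b => f (a, b)) fun b => g (a, b)) :
    TransfersIntegral K c f g := by
  have hnorm : Integrable fun a => K * ∫ b, ‖g (a, b)‖ := hg.norm.integral_prod_left.const_mul K
  have hint : Integrable f := by
    refine (integrable_prod_iff hf).2 ⟨h.mono fun a ha => ha.integrable,
      hnorm.mono' hf.norm.integral_prod_right' (h.mono fun a ha => ?_)⟩
    rw [Real.norm_of_nonneg (integral_nonneg fun _ => norm_nonneg _)]
    exact ha.integral_norm_le
  refine ⟨hint, ?_, ?_⟩
  · calc ∫ p, ‖f p‖ = ∫ a, ∫ b, ‖f (a, b)‖ := integral_prod _ hint.norm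
      _ ≤ ∫ a, K * ∫ b, ‖g (a, b)‖ := integral_mono_ae hint.norm.integral_prod_left hnorm
          (h.mono fun a ha => ha.integral_norm_le)
      _ = K * ∫ p, ‖g p‖ := by rw [integral_const_mul, Measure.volume_eq_prod,
          integral_prod _ hg.norm]
  · calc ∫ p, f p = ∫ a, ∫ b, f (a, b) := integral_prod _ hint
      _ = ∫ a, c • ∫ b, g (a, b) := integral_congr_ae (h.mono fun a ha => ha.integral_eq)
      _ = c • ∫ p, g p := by rw [integral_smul, Measure.volume_eq_prod, integral_prod _ hg]

end TransfersIntegral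

section Chain

open Polynomial

variable {m M n J : ℕ} {X V : Type*} [NormedAddCommGroup V] [NormedSpace ℝ V]

/-- Splitting a vector of length `m + M` into vectors of lengths `m` and `M`. -/
def finAppendEquiv (m M : ℕ) : (Fin (m + M) → ℝ) ≃ᵐ (Fin m → ℝ) × (Fin M → ℝ) :=
  (MeasurableEquiv.arrowCongr' finSumFinEquiv.symm (MeasurableEquiv.refl ℝ)).trans
    (MeasurableEquiv.sumPiEquivProdPi fun _ => ℝ)

theorem measurePreserving_finAppendEquiv : MeasurePreserving (finAppendEquiv m M) :=
  (volume_preserving_arrowCongr' _ _ (MeasurePreserving.id _)).trans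
    (volume_measurePreserving_sumPiEquivProdPi fun _ => ℝ)

theorem finAppendEquiv_apply (x : Fin (m + M) → ℝ) : finAppendEquiv m M x =
    (fun j => x (Fin.castAdd M j), fun j => x (Fin.natAdd m j)) := rfl

theorem headPoly_finAppendEquiv_symm (p : (Fin m → ℝ) × (Fin M → ℝ)) :
    headPoly ((finAppendEquiv m M).symm p) = monicPoly p.1 := by
  have h := (finAppendEquiv m M).apply_symm_apply p
  rw [finAppendEquiv_apply] at h
  exact congrArg monicPoly (congrArg Prod.fst h)

theorem tailPoly_finAppendEquiv_symm (p : (Fin m → ℝ) × (Fin M → ℝ)) :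
    tailPoly ((finAppendEquiv m M).symm p) = monicPoly p.2 := by
  have h := (finAppendEquiv m M).apply_symm_apply p
  rw [finAppendEquiv_apply] at h
  exact congrArg monicPoly (congrArg Prod.snd h)

theorem transfersIntegral_resultant_smul_mul [CompleteSpace V] (M : ℕ) {h : ℝ[X] → V}
    (hh : Integrable fun b : Fin (2 + M) → ℝ => h (monicPoly b)) :
    TransfersIntegral ((2 + M) * (3 + M) : ℕ) ((2 + M) / 2 : ℕ)
      (fun p : (Fin 2 → ℝ) × (Fin M → ℝ) =>
        resultant (monicPoly p.1) (monicPoly p.2) • h (monicPoly p.1 * monicPoly p.2))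
      fun b : Fin (2 + M) → ℝ => h (monicPoly b) := by
  obtain ⟨hint, hnorm, heq⟩ := integral_det_smul_comp_eq (hasFDerivAt_mulMap (m := 2) (M := M))
    continuous_mulMapDeriv ((ae_separable_monicPoly (2 + M)).mono fun y => exists_fibre_mulMap) hh
  have hcomp := (TransfersIntegral.mk hint hnorm heq).comp
    (measurePreserving_finAppendEquiv (m := 2) (M := M)).symm
  convert! hcomp using 2 with p
  rw [det_mulMapDeriv, monicPoly_mulMap, headPoly_finAppendEquiv_symm,
    tailPoly_finAppendEquiv_symm]

/-- The product of quadratic monic polynomials and a monic polynomial of degree `M`. -/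
noncomputable def prodPoly (q : Fin J → Fin 2 → ℝ) (w : Fin M → ℝ) : ℝ[X] :=
  (∏ i, monicPoly (q i)) * monicPoly w

/-- The Jacobian of the multiplication map `(q, w) ↦ prodPoly q w`, built from resultants. -/
noncomputable def chainResultant (w : Fin M → ℝ) : {J : ℕ} → (Fin J → Fin 2 → ℝ) → ℝ
  | 0, _ => 1
  | _ + 1, q => resultant (monicPoly (q 0)) (prodPoly (fun i => q i.succ) w) *
      chainResultant w fun i => q i.succ

theorem prodPoly_zero (q : Fin 0 → Fin 2 → ℝ) (w : Fin M → ℝ) : prodPoly q w = monicPoly w := by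
  rw [prodPoly, Fin.prod_univ_zero, one_mul]

theorem prodPoly_succ (q : Fin (J + 1) → Fin 2 → ℝ) (w : Fin M → ℝ) :
    prodPoly q w = monicPoly (q 0) * prodPoly (fun i => q i.succ) w := by
  rw [prodPoly, prodPoly, Fin.prod_univ_succ, mul_assoc]

theorem monic_prodPoly (q : Fin J → Fin 2 → ℝ) (w : Fin M → ℝ) : (prodPoly q w).Monic :=
  (monic_prod_of_monic _ _ fun _ _ => monic_monicPoly _).mul (monic_monicPoly _)

theorem natDegree_prodPoly (q : Fin J → Fin 2 → ℝ) (w : Fin M → ℝ) :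
    (prodPoly q w).natDegree = 2 * J + M := by
  rw [prodPoly, (monic_prod_of_monic _ _ fun _ _ => monic_monicPoly _).natDegree_mul
    (monic_monicPoly _), natDegree_prod_of_monic _ _ fun _ _ => monic_monicPoly _]
  simp [mul_comm]

section Continuity

variable [TopologicalSpace X]

theorem continuous_coeff_mul {f g : X → ℝ[X]} (hf : ∀ k, Continuous fun x => (f x).coeff k)
    (hg : ∀ k, Continuous fun x => (g x).coeff k) (k : ℕ) :
    Continuous fun x => (f x * g x).coeff k := by
  simp only [coeff_mul]
  exact continuous_finsetSum _ fun i _ => (hf _).mul (hg _)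

theorem continuous_coeff_prodPoly {q : X → Fin J → Fin 2 → ℝ} {w : X → Fin M → ℝ}
    (hq : Continuous q) (hw : Continuous w) (k : ℕ) :
    Continuous fun x => (prodPoly (q x) (w x)).coeff k := by
  induction J generalizing k with
  | zero =>
    simp only [prodPoly_zero]
    exact (continuous_coeff_monicPoly k).comp hw
  | succ J ih =>
    simp only [prodPoly_succ]
    exact continuous_coeff_mul (fun k => (continuous_coeff_monicPoly k).comp (by fun_prop))
      (ih (q := fun x i => q x i.succ) (by fun_prop)) k

theorem continuous_resultant {f g : X → ℝ[X]} (hf : ∀ k, Continuous fun x => (f x).coeff k)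
    (hg : ∀ k, Continuous fun x => (g x).coeff k) (hfd : ∀ x, (f x).natDegree = m)
    (hgd : ∀ x, (g x).natDegree = n) : Continuous fun x => resultant (f x) (g x) := by
  have hdet : (fun x => resultant (f x) (g x)) = fun x => (sylvester (f x) (g x) m n).det := by
    ext x
    rw [resultant, hfd, hgd]
  rw [hdet]
  exact (continuous_sylvester hf hg).matrix_det

theorem continuous_chainResultant {q : X → Fin J → Fin 2 → ℝ} {w : X → Fin M → ℝ}
    (hq : Continuous q) (hw : Continuous w) : Continuous fun x => chainResultant (w x) (q x) := by
  induction J with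
  | zero => exact continuous_const
  | succ J ih =>
    have htail : Continuous fun x (i : Fin J) => q x i.succ := by fun_prop
    exact (continuous_resultant (fun k => (continuous_coeff_monicPoly k).comp (by fun_prop))
      (continuous_coeff_prodPoly htail hw) (fun _ => natDegree_monicPoly _)
      fun _ => natDegree_prodPoly _ _).mul (ih htail)

theorem stronglyMeasurable_comp_of_monic [MeasurableSpace X] [OpensMeasurableSpace X]
    {Y : Type*} [TopologicalSpace Y] {h : ℝ[X] → Y}
    (hm : StronglyMeasurable fun b : Fin n → ℝ => h (monicPoly b)) {f : X → ℝ[X]}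
    (hf : ∀ k, Continuous fun x => (f x).coeff k) (hfm : ∀ x, (f x).Monic)
    (hfd : ∀ x, (f x).natDegree = n) : StronglyMeasurable fun x => h (f x) := by
  have hcoeff : Continuous fun x (i : Fin n) => (f x).coeff i := continuous_pi fun i => hf i
  simpa only [Function.comp_def, monicPoly_coeff (hfm _) (hfd _)] using
    hm.comp_measurable hcoeff.measurable

theorem stronglyMeasurable_resultant_smul [MeasurableSpace X] [OpensMeasurableSpace X]
    {h : ℝ[X] → V} (hm : StronglyMeasurable fun b : Fin (2 + n) → ℝ => h (monicPoly b))
    {q : X → Fin 2 → ℝ} {g : X → ℝ[X]} (hq : Continuous q)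
    (hg : ∀ k, Continuous fun x => (g x).coeff k) (hgm : ∀ x, (g x).Monic)
    (hgd : ∀ x, (g x).natDegree = n) :
    StronglyMeasurable fun x => resultant (monicPoly (q x)) (g x) • h (monicPoly (q x) * g x) := by
  have hcoeff := fun k => (continuous_coeff_monicPoly k).comp hq
  refine (continuous_resultant hcoeff hg (fun _ => natDegree_monicPoly _) hgd).measurable
    |>.stronglyMeasurable.smul (stronglyMeasurable_comp_of_monic hm (continuous_coeff_mul hcoeff hg)
      (fun x => (monic_monicPoly _).mul (hgm x)) fun x => ?_)
  rw [(monic_monicPoly _).natDegree_mul (hgm x), natDegree_monicPoly, hgd]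

end Continuity

/-- Splitting off the first quadratic factor. -/
def consEquiv (J M : ℕ) : (Fin (J + 1) → Fin 2 → ℝ) × (Fin M → ℝ) ≃ᵐ
    (Fin 2 → ℝ) × ((Fin J → Fin 2 → ℝ) × (Fin M → ℝ)) :=
  ((MeasurableEquiv.piFinSuccAbove (fun _ : Fin (J + 1) => Fin 2 → ℝ) 0).prodCongr
    (MeasurableEquiv.refl (Fin M → ℝ))).trans MeasurableEquiv.prodAssoc

theorem measurePreserving_consEquiv (J M : ℕ) : MeasurePreserving (consEquiv J M) :=
  ((volume_preserving_piFinSuccAbove (fun _ : Fin (J + 1) => Fin 2 → ℝ) 0).prod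
    (MeasurePreserving.id volume)).trans
      (measurePreserving_prodAssoc (volume : Measure (Fin 2 → ℝ))
        (volume : Measure (Fin J → Fin 2 → ℝ)) (volume : Measure (Fin M → ℝ)))

theorem transfersIntegral_chainResultant_smul [CompleteSpace V] (hn : n = 2 * J + M)
    {h : ℝ[X] → V}
    (hm : StronglyMeasurable fun b : Fin n → ℝ => h (monicPoly b))
    (hh : Integrable fun b : Fin n → ℝ => h (monicPoly b)) :
    TransfersIntegral (∏ i ∈ Finset.range J, ((2 + (2 * i + M)) * (3 + (2 * i + M)) : ℕ) : ℕ)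
      ((M / 2 + 1).ascFactorial J)
      (fun p : (Fin J → Fin 2 → ℝ) × (Fin M → ℝ) =>
        chainResultant p.2 p.1 • h (prodPoly p.1 p.2))
      fun b : Fin n → ℝ => h (monicPoly b) := by
  induction J generalizing n h with
  | zero =>
    obtain rfl : n = M := by omega
    have : IsProbabilityMeasure (volume : Measure (Fin 0 → Fin 2 → ℝ)) := by
      rw [volume_pi, Measure.pi_of_empty]
      infer_instance
    have hsnd : MeasurePreserving (Prod.snd : (Fin 0 → Fin 2 → ℝ) × (Fin n → ℝ) → Fin n → ℝ) :=
      measurePreserving_snd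
    simpa [chainResultant, prodPoly_zero] using transfersIntegral_comp hsnd hh
  | succ J ih =>
    obtain rfl : n = 2 + (2 * J + M) := by omega
    have hfirst := transfersIntegral_resultant_smul_mul (2 * J + M) hh
    have hrest := TransfersIntegral.prod (c := (M / 2 + 1).ascFactorial J)
      (f := fun p : (Fin 2 → ℝ) × ((Fin J → Fin 2 → ℝ) × (Fin M → ℝ)) =>
        chainResultant p.2.2 p.2.1 • resultant (monicPoly p.1) (prodPoly p.2.1 p.2.2) •
          h (monicPoly p.1 * prodPoly p.2.1 p.2.2)) ?_ hfirst.integrable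
      (hfirst.integrable.prod_right_ae.mono fun q hq =>
        ih (h := fun g => resultant (monicPoly q) g • h (monicPoly q * g)) rfl ?_ hq)
    · have hsplit := (hrest.trans (Nat.cast_nonneg _) hfirst).comp (measurePreserving_consEquiv J M)
      convert! hsplit using 2 with p
      · rw [Finset.prod_range_succ, Nat.cast_mul]
      · rw [← Nat.cast_mul, mul_comm, show (2 + (2 * J + M)) / 2 = M / 2 + 1 + J by omega,
          Nat.ascFactorial_succ]
      · rw [chainResultant, prodPoly_succ, smul_smul, mul_comm]
        rfl
    · exact ((continuous_chainResultant (by fun_prop) (by fun_prop)).measurable.stronglyMeasurable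
        |>.smul (stronglyMeasurable_resultant_smul hm continuous_fst
          (continuous_coeff_prodPoly (by fun_prop) (by fun_prop)) (fun _ => monic_prodPoly _ _)
            fun _ => natDegree_prodPoly _ _)).aestronglyMeasurable
    · exact stronglyMeasurable_resultant_smul hm continuous_const continuous_coeff_monicPoly
        monic_monicPoly natDegree_monicPoly

end Chain

section QuadraticIntegral

open Polynomial
open scoped ComplexConjugate

theorem integrableOn_and_setIntegral_image_of_abs_det {E X V : Type*} [NormedAddCommGroup E]
    [NormedSpace ℝ E] [FiniteDimensional ℝ E] [MeasureSpace E] [BorelSpace E]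
    [(volume : Measure E).IsAddHaarMeasure] [MeasureSpace X] [NormedAddCommGroup V]
    [NormedSpace ℝ V] {e : E ≃ᵐ X} (he : MeasurePreserving e) {t : Set X} (ht : MeasurableSet t)
    {G : X → E} (hinj : Set.InjOn G t) {F' : E → E →L[ℝ] E}
    (hF' : ∀ x, HasFDerivAt (fun x => G (e x)) (F' x) x) {d : X → ℝ}
    (hd : ∀ x, e x ∈ t → |(F' x).det| = d (e x)) {f : E → V}
    (hf : IntegrableOn (fun p => d p • f (G p)) t) :
    IntegrableOn f (G '' t) ∧ ∫ x in G '' t, f x = ∫ p in t, d p • f (G p) := by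
  have hs : MeasurableSet (e ⁻¹' t) := e.measurable ht
  have hderiv := fun x (_ : x ∈ e ⁻¹' t) => (hF' x).hasFDerivWithinAt (s := e ⁻¹' t)
  have hinj' : Set.InjOn (fun x => G (e x)) (e ⁻¹' t) :=
    fun x hx y hy hxy => e.injective (hinj hx hy hxy)
  have himage : G '' t = (fun x => G (e x)) '' (e ⁻¹' t) := by
    rw [← Function.comp_def, Set.image_comp, Set.image_preimage_eq t e.surjective]
  have hdensity : Set.EqOn (fun x => |(F' x).det| • f (G (e x)))
      (fun x => (fun p => d p • f (G p)) (e x)) (e ⁻¹' t) := fun x hx => by simp only [hd x hx]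
  rw [himage]
  constructor
  · rw [integrableOn_image_iff_integrableOn_abs_det_fderiv_smul volume hs hderiv hinj',
      integrableOn_congr_fun hdensity hs]
    exact (he.integrableOn_comp_preimage e.measurableEmbedding).2 hf
  · rw [integral_image_eq_integral_abs_det_fderiv_smul volume hs hderiv hinj',
      setIntegral_congr_fun hs hdensity]
    exact he.setIntegral_preimage_emb e.measurableEmbedding (fun p => d p • f (G p)) t

/-- The linear endomorphism of the plane given by a matrix. -/
noncomputable def planeMap (A : Matrix (Fin 2) (Fin 2) ℝ) : (Fin 2 → ℝ) →L[ℝ] (Fin 2 → ℝ) :=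
  (Matrix.toLin' A).toContinuousLinearMap

theorem det_planeMap (A : Matrix (Fin 2) (Fin 2) ℝ) : (planeMap A).det = A.det := by
  rw [planeMap, LinearMap.det_toContinuousLinearMap, LinearMap.det_toLin']

theorem hasFDerivAt_planeMap {F : (Fin 2 → ℝ) → Fin 2 → ℝ} {A : Matrix (Fin 2) (Fin 2) ℝ}
    {x : Fin 2 → ℝ}
    (h : ∀ i, HasFDerivAt (fun y => F y i)
      (A i 0 • (ContinuousLinearMap.proj 0 : (Fin 2 → ℝ) →L[ℝ] ℝ) +
        A i 1 • (ContinuousLinearMap.proj 1 : (Fin 2 → ℝ) →L[ℝ] ℝ)) x) :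
    HasFDerivAt F (planeMap A) x := by
  refine hasFDerivAt_pi'.2 fun i => (h i).congr_fderiv (ContinuousLinearMap.ext fun v => ?_)
  fin_cases i <;> simp [planeMap]

theorem pairCoeff_ofReal (x y : ℝ) : pairCoeff x y = ![x * y, -(x + y)] := by
  simp [pairCoeff]

theorem pairCoeff_conj (β : ℂ) : pairCoeff (conj β) β = ![β.re ^ 2 + β.im ^ 2, -(2 * β.re)] := by
  rw [pairCoeff, Complex.mul_re, Complex.add_re, Complex.conj_re, Complex.conj_im]
  ring_nf

theorem hasFDerivAt_pairCoeff_ofReal (x : Fin 2 → ℝ) :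
    HasFDerivAt (fun y : Fin 2 → ℝ => pairCoeff (y 0) (y 1))
      (planeMap !![x 1, x 0; -1, -1]) x := by
  have hproj := fun i => hasFDerivAt_apply (𝕜 := ℝ) (F' := fun _ : Fin 2 => ℝ) i x
  refine hasFDerivAt_planeMap (Fin.forall_fin_two.2 ⟨?_, ?_⟩)
  · refine (((hproj 0).mul (hproj 1)).congr_fderiv ?_).congr_of_eventuallyEq
      (.of_forall fun y => by simp [pairCoeff_ofReal])
    exact add_comm _ _
  · refine (((hproj 0).add (hproj 1)).neg.congr_fderiv ?_).congr_of_eventuallyEq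
      (.of_forall fun y => by simp [pairCoeff_ofReal])
    ext v
    simp [add_comm]

theorem hasFDerivAt_pairCoeff_conj (x : Fin 2 → ℝ) :
    HasFDerivAt (fun y => pairCoeff (conj (Complex.measurableEquivPi.symm y))
      (Complex.measurableEquivPi.symm y)) (planeMap !![2 * x 0, 2 * x 1; -2, 0]) x := by
  have hproj := fun i => hasFDerivAt_apply (𝕜 := ℝ) (F' := fun _ : Fin 2 => ℝ) i x
  refine hasFDerivAt_planeMap (Fin.forall_fin_two.2 ⟨?_, ?_⟩)
  · refine ((((hproj 0).pow 2).add ((hproj 1).pow 2)).congr_fderiv ?_).congr_of_eventuallyEq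
      (.of_forall fun y => by simp only [pairCoeff_conj]; simp)
    ext v
    simp
  · refine (((hproj 0).const_mul 2).neg.congr_fderiv ?_).congr_of_eventuallyEq
      (.of_forall fun y => by simp only [pairCoeff_conj]; simp)
    ext v
    simp

theorem injOn_pairCoeff_ofReal :
    Set.InjOn (fun p : ℝ × ℝ => pairCoeff p.1 p.2) {p | p.1 < p.2} := by
  intro p hp p' hp' h
  obtain ⟨hlow, hhigh⟩ := roots_pairCoeff_ofReal hp
  obtain ⟨hlow', hhigh'⟩ := roots_pairCoeff_ofReal hp'
  exact Prod.ext (Complex.ofReal_injective (hlow.symm.trans ((congrArg lowRoot h).trans hlow')))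
    (Complex.ofReal_injective (hhigh.symm.trans ((congrArg highRoot h).trans hhigh')))

theorem injOn_pairCoeff_conj : Set.InjOn (fun β => pairCoeff (conj β) β) {β : ℂ | 0 < β.im} :=
  Set.LeftInvOn.injOn fun _ hβ => (roots_pairCoeff_conj hβ).2

theorem image_pairCoeff_ofReal :
    (fun p : ℝ × ℝ => pairCoeff p.1 p.2) '' {p | p.1 < p.2} = {q | 0 < quadDisc q} := by
  ext q
  constructor
  · rintro ⟨p, hp, rfl⟩
    rw [Set.mem_ofPred_eq, quadDisc_pairCoeff_ofReal]
    exact pow_pos (sub_pos.2 hp) 2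
  · intro hq
    obtain ⟨x, y, hxy, hx, hy⟩ := exists_ofReal_roots_of_quadDisc_pos hq
    exact ⟨(x, y), hxy, by simp only [← hx, ← hy, pairCoeff_lowRoot_highRoot]⟩

theorem image_pairCoeff_conj :
    (fun β => pairCoeff (conj β) β) '' {β : ℂ | 0 < β.im} = {q | quadDisc q < 0} := by
  ext q
  constructor
  · rintro ⟨β, hβ, rfl⟩
    rw [Set.mem_ofPred_eq, quadDisc_pairCoeff_conj, neg_lt_zero]
    exact pow_pos (mul_pos two_pos hβ) 2
  · intro hq
    obtain ⟨him, hconj⟩ := conj_roots_of_quadDisc_neg hq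
    exact ⟨highRoot q, him, by simp only [← hconj, pairCoeff_lowRoot_highRoot]⟩

theorem continuous_quadDisc : Continuous quadDisc := by
  unfold quadDisc
  fun_prop

theorem ae_quadDisc_ne_zero : ∀ᵐ q : Fin 2 → ℝ, quadDisc q ≠ 0 := by
  filter_upwards [ae_separable_monicPoly 2] with q hq hzero
  have hsq := (hq.map (f := algebraMap ℝ ℂ)).squarefree
  rw [map_monicPoly_two, (quadDisc_eq_zero_iff q).1 hzero] at hsq
  exact (irreducible_X_sub_C _).not_isUnit (hsq _ dvd_rfl)

variable {V : Type*} [NormedAddCommGroup V] [NormedSpace ℝ V] {H : ℂ → ℂ → V}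

theorem integral_of_quadDisc_pos
    (hH : IntegrableOn (fun p : ℝ × ℝ => (p.2 - p.1) • H p.1 p.2) {p | p.1 < p.2}) :
    IntegrableOn (fun q => H (lowRoot q) (highRoot q)) {q | 0 < quadDisc q} ∧
      ∫ q in {q | 0 < quadDisc q}, H (lowRoot q) (highRoot q) =
        ∫ p in {p : ℝ × ℝ | p.1 < p.2}, (p.2 - p.1) • H p.1 p.2 := by
  have ht : MeasurableSet {p : ℝ × ℝ | p.1 < p.2} := measurableSet_lt measurable_fst measurable_snd
  have hroots : Set.EqOn (fun p : ℝ × ℝ => (p.2 - p.1) • H p.1 p.2)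
      (fun p => (p.2 - p.1) •
        H (lowRoot (pairCoeff p.1 p.2)) (highRoot (pairCoeff p.1 p.2))) {p | p.1 < p.2} := by
    intro p hp
    obtain ⟨hlow, hhigh⟩ := roots_pairCoeff_ofReal hp
    simp only [hlow, hhigh]
  rw [← image_pairCoeff_ofReal, setIntegral_congr_fun ht hroots]
  refine integrableOn_and_setIntegral_image_of_abs_det (volume_preserving_finTwoArrow ℝ) ht
    injOn_pairCoeff_ofReal hasFDerivAt_pairCoeff_ofReal (fun x (hx : x 0 < x 1) => ?_)
    ((integrableOn_congr_fun hroots ht).1 hH)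
  rw [det_planeMap, Matrix.det_fin_two_of, mul_neg_one, mul_neg_one, neg_sub_neg,
    abs_sub_comm, abs_of_pos (sub_pos.2 hx)]
  rfl

theorem integral_of_quadDisc_neg
    (hH : IntegrableOn (fun β : ℂ => (4 * β.im) • H (conj β) β) {β | 0 < β.im}) :
    IntegrableOn (fun q => H (lowRoot q) (highRoot q)) {q | quadDisc q < 0} ∧
      ∫ q in {q | quadDisc q < 0}, H (lowRoot q) (highRoot q) =
        ∫ β in {β : ℂ | 0 < β.im}, (4 * β.im) • H (conj β) β := by
  have ht : MeasurableSet {β : ℂ | 0 < β.im} :=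
    measurableSet_lt measurable_const Complex.measurable_im
  have hroots : Set.EqOn (fun β : ℂ => (4 * β.im) • H (conj β) β)
      (fun β => (4 * β.im) • H (lowRoot (pairCoeff (conj β) β)) (highRoot (pairCoeff (conj β) β)))
      {β | 0 < β.im} := by
    intro β hβ
    obtain ⟨hlow, hhigh⟩ := roots_pairCoeff_conj hβ
    simp only [hlow, hhigh]
  rw [← image_pairCoeff_conj, setIntegral_congr_fun ht hroots]
  refine integrableOn_and_setIntegral_image_of_abs_det Complex.volume_preserving_equiv_pi.symm ht
    injOn_pairCoeff_conj hasFDerivAt_pairCoeff_conj (fun x hx => ?_)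
    ((integrableOn_congr_fun hroots ht).1 hH)
  have him : (Complex.measurableEquivPi.symm x).im = x 1 := by simp
  rw [Set.mem_ofPred_eq, him] at hx
  rw [det_planeMap, Matrix.det_fin_two_of, him, mul_zero, zero_sub, mul_neg, neg_neg,
    abs_of_pos (by positivity)]
  ring

theorem integral_comp_roots
    (hreal : IntegrableOn (fun p : ℝ × ℝ => (p.2 - p.1) • H p.1 p.2) {p | p.1 < p.2})
    (hconj : IntegrableOn (fun β : ℂ => (4 * β.im) • H (conj β) β) {β | 0 < β.im}) :
    Integrable (fun q => H (lowRoot q) (highRoot q)) ∧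
      ∫ q, H (lowRoot q) (highRoot q) =
        (∫ p in {p : ℝ × ℝ | p.1 < p.2}, (p.2 - p.1) • H p.1 p.2) +
          ∫ β in {β : ℂ | 0 < β.im}, (4 * β.im) • H (conj β) β := by
  obtain ⟨hintPos, heqPos⟩ := integral_of_quadDisc_pos hreal
  obtain ⟨hintNeg, heqNeg⟩ := integral_of_quadDisc_neg hconj
  have hneg : MeasurableSet {q | quadDisc q < 0} :=
    (isOpen_lt continuous_quadDisc continuous_const).measurableSet
  have hdisj : Disjoint {q | 0 < quadDisc q} {q | quadDisc q < 0} :=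
    Set.disjoint_left.2 fun q (hpos : 0 < quadDisc q) hneg => lt_asymm hpos hneg
  have hunion : ({q | 0 < quadDisc q} ∪ {q | quadDisc q < 0} : Set (Fin 2 → ℝ)) =ᵐ[volume]
      Set.univ :=
    Filter.eventuallyEq_univ.2 (ae_quadDisc_ne_zero.mono fun q hq => (lt_or_gt_of_ne hq).symm)
  constructor
  · rw [← integrableOn_univ, ← integrableOn_congr_set_ae hunion]
    exact hintPos.union hintNeg
  · rw [← setIntegral_univ, ← setIntegral_congr_set hunion,
      setIntegral_union hdisj hneg hintPos hintNeg, heqPos, heqNeg]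

end QuadraticIntegral

section PairPermutations

open Equiv Finset

theorem prodCongrLeft_injective {α β : Type*} :
    Function.Injective fun π : β → Perm α => (prodCongrLeft π : Perm (α × β)) := by
  intro π π' h
  ext s a
  exact congrArg (fun σ : Perm (α × β) => (σ (a, s)).1) h

theorem exists_prodCongrLeft_eq {α β : Type*} [Finite α] {σ : Perm (α × β)}
    (hσ : ∀ x, (σ x).2 = x.2) : ∃ π : β → Perm α, prodCongrLeft π = σ := by
  have hinj (s : β) : Function.Injective fun a => (σ (a, s)).1 := by
    intro a b hab
    have hpair : σ (a, s) = σ (b, s) := Prod.ext hab ((hσ (a, s)).trans (hσ (b, s)).symm)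
    exact congrArg Prod.fst (σ.injective hpair)
  refine ⟨fun s => Equiv.ofBijective _ (Finite.injective_iff_bijective.1 (hinj s)), ?_⟩
  ext1 ⟨a, s⟩
  exact Prod.ext rfl (hσ (a, s)).symm

variable {α R : Type*} [Fintype α] [DecidableEq α] [CommRing R]

/-- The signed sum of `∏ i, B i (σ (i, 0)) (σ (i, 1))` over the permutations `σ` of `α × Fin 2`.
When `B i` does not depend on `i`, it is a multiple of the Pfaffian of `B x y - B y x`. -/
def pairSum (B : α → α × Fin 2 → α × Fin 2 → R) : R :=
  ∑ σ : Perm (α × Fin 2), (Perm.sign σ : R) * ∏ i, B i (σ (i, 0)) (σ (i, 1))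

theorem sub_swap_eq_sum_perm {β : Type*} (f : β → β → R) (x : Fin 2 → β) :
    f (x 0) (x 1) - f (x 1) (x 0) =
      ∑ π : Perm (Fin 2), (Perm.sign π : R) * f (x (π 0)) (x (π 1)) := by
  have huniv : (univ : Finset (Perm (Fin 2))) = {1, swap 0 1} := by decide
  rw [huniv, sum_pair (by decide), Perm.sign_swap (by decide)]
  simp [sub_eq_add_neg]

theorem pairSum_sub_swap (B : α → α × Fin 2 → α × Fin 2 → R) :
    pairSum (fun i x y => B i x y - B i y x) = 2 ^ Fintype.card α * pairSum B := by
  let term (σ : Perm (α × Fin 2)) : R := Perm.sign σ * ∏ i, B i (σ (i, 0)) (σ (i, 1))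
  have hexpand (σ : Perm (α × Fin 2)) :
      (Perm.sign σ : R) * ∏ i, (B i (σ (i, 0)) (σ (i, 1)) - B i (σ (i, 1)) (σ (i, 0))) =
        ∑ ε : α → Perm (Fin 2), term (σ * prodCongrRight ε) := by
    simp_rw [fun i => sub_swap_eq_sum_perm (B i) fun s => σ (i, s)]
    rw [prod_univ_sum, mul_sum, Fintype.piFinset_univ]
    refine sum_congr rfl fun ε _ => ?_
    simp only [term, prod_mul_distrib, Perm.sign_mul, Perm.sign_prodCongrRight, Perm.mul_apply,
      prodCongrRight_apply, Units.val_mul, Units.coe_prod, Int.cast_mul, Int.cast_prod, mul_assoc]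
  have hshift (ε : α → Perm (Fin 2)) : ∑ σ, term (σ * prodCongrRight ε) = pairSum B :=
    Equiv.sum_comp (Equiv.mulRight (prodCongrRight ε : Perm (α × Fin 2))) term
  rw [pairSum, sum_congr rfl fun σ _ => hexpand σ, sum_comm, sum_congr rfl fun ε _ => hshift ε,
    sum_const, card_univ, Fintype.card_fun, Fintype.card_perm, Fintype.card_fin, nsmul_eq_mul,
    Nat.factorial_two, Nat.cast_pow, Nat.cast_ofNat]

theorem pairSum_eq_of_sub_swap_eq [NoZeroDivisors R] [NeZero (2 : R)]
    {B C : α → α × Fin 2 → α × Fin 2 → R}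
    (h : ∀ i x y, B i x y - B i y x = C i x y - C i y x) : pairSum B = pairSum C := by
  have hB := pairSum_sub_swap B
  simp_rw [h] at hB
  exact mul_left_cancel₀ (pow_ne_zero _ two_ne_zero) (hB.symm.trans (pairSum_sub_swap C))

theorem pairSum_eq_sum_prodCongrLeft {B : α → α × Fin 2 → α × Fin 2 → R}
    (hB : ∀ i x y, ¬(x.2 = 0 ∧ y.2 = 1) → B i x y = 0) :
    pairSum B = ∑ π : Fin 2 → Perm α, (Perm.sign (prodCongrLeft π : Perm (α × Fin 2)) : R) *
      ∏ i, B i (π 0 i, 0) (π 1 i, 1) := by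
  refine (sum_of_injOn (fun π : Fin 2 → Perm α => (prodCongrLeft π : Perm (α × Fin 2)))
    prodCongrLeft_injective.injOn (by simp) (fun σ _ hσ => ?_) (by simp)).symm
  by_contra hne
  have hfactor (i : α) : (σ (i, 0)).2 = 0 ∧ (σ (i, 1)).2 = 1 := by
    by_contra hi
    exact hne (mul_eq_zero_of_right _ (prod_eq_zero (mem_univ i) (hB i _ _ hi)))
  obtain ⟨π, hπ⟩ := exists_prodCongrLeft_eq (σ := σ) fun ⟨a, s⟩ => by
    fin_cases s
    exacts [(hfactor a).1, (hfactor a).2]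
  exact hσ ⟨π, by simp, hπ⟩

theorem pairSum_of_bipartite (u : α → α → α → R) :
    pairSum (fun i x y => if x.2 = 0 ∧ y.2 = 1 then u i x.1 y.1 else 0) =
      ∑ τ : Perm α, (Perm.sign τ : R) * (Matrix.of fun r i => u i r (τ i)).det := by
  rw [pairSum_eq_sum_prodCongrLeft fun _ _ _ h => if_neg h,
    ← Equiv.sum_comp (finTwoArrowEquiv (Perm α)).symm, Fintype.sum_prod_type_right]
  refine sum_congr rfl fun τ _ => ?_
  rw [Matrix.det_apply', mul_sum]
  refine sum_congr rfl fun π _ => ?_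
  rw [Perm.sign_prodCongrLeft, Fin.prod_univ_two]
  simp [mul_left_comm, mul_assoc]

theorem pairSum_eq_sum_det [NoZeroDivisors R] [NeZero (2 : R)]
    {B : α → α × Fin 2 → α × Fin 2 → R} (h : ∀ i j k s, B i (j, s) (k, s) = B i (k, s) (j, s)) :
    pairSum B = ∑ τ : Perm α, (Perm.sign τ : R) *
      (Matrix.of fun r i => B i (r, 0) (τ i, 1) - B i (τ i, 1) (r, 0)).det := by
  rw [← pairSum_of_bipartite fun i r k => B i (r, 0) (k, 1) - B i (k, 1) (r, 0)]
  refine pairSum_eq_of_sub_swap_eq fun i ⟨j, s⟩ ⟨k, t⟩ => ?_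
  fin_cases s <;> fin_cases t <;> simp [h i j k]

theorem sign_mul_det_submatrix_id (A : Matrix α α R) (τ : Perm α) :
    (Perm.sign τ : R) * (A.submatrix id τ).det = A.det := by
  rw [Matrix.det_permute', ← mul_assoc, ← Int.cast_mul, ← Units.val_mul, Int.units_mul_self,
    Units.val_one, Int.cast_one, one_mul]

theorem pairSum_const [NoZeroDivisors R] [NeZero (2 : R)] {B : α × Fin 2 → α × Fin 2 → R}
    (h : ∀ j k s, B (j, s) (k, s) = B (k, s) (j, s)) :
    pairSum (fun _ : α => B) = (Fintype.card α).factorial *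
      (Matrix.of fun r i => B (r, 0) (i, 1) - B (i, 1) (r, 0)).det := by
  rw [pairSum_eq_sum_det fun _ => h, ← Fintype.card_perm, ← card_univ, ← nsmul_eq_mul]
  exact sum_eq_card_nsmul fun τ _ => sign_mul_det_submatrix_id
    (Matrix.of fun r i => B (r, 0) (i, 1) - B (i, 1) (r, 0)) τ

theorem card_perm_fixing (a : α) :
    #{τ : Perm α | τ a = a} = (Fintype.card α - 1).factorial := by
  have h := Fintype.card_congr (Equiv.Perm.subtypeEquivSubtypePerm fun x : α => x ≠ a)
  rw [Fintype.card_perm, Fintype.card_subtype_compl, Fintype.card_subtype_eq] at h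
  rw [h, Fintype.card_subtype]
  simp only [not_not, forall_eq]

theorem pairSum_update [NoZeroDivisors R] [NeZero (2 : R)] (a : α)
    {B B' : α × Fin 2 → α × Fin 2 → R} (h : ∀ j k s, B (j, s) (k, s) = B (k, s) (j, s))
    (h' : ∀ j k s, B' (j, s) (k, s) = B' (k, s) (j, s))
    (hB' : ∀ r k, k ≠ a → B' (r, 0) (k, 1) - B' (k, 1) (r, 0) = 0) :
    pairSum (Function.update (fun _ => B) a B') = (Fintype.card α - 1).factorial *
      (Matrix.of fun r i => Function.update (fun _ => B) a B' i (r, 0) (i, 1) -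
        Function.update (fun _ => B) a B' i (i, 1) (r, 0)).det := by
  have hsymm (i j k s) : Function.update (fun _ => B) a B' i (j, s) (k, s) =
      Function.update (fun _ => B) a B' i (k, s) (j, s) := by
    rcases eq_or_ne i a with rfl | hi
    · simp only [Function.update_self, h']
    · simp only [Function.update_of_ne hi, h]
  rw [pairSum_eq_sum_det hsymm, ← card_perm_fixing a, ← nsmul_eq_mul, ← sum_const, sum_filter]
  refine sum_congr rfl fun τ _ => ?_
  split_ifs with hτ
  · refine Eq.trans (congrArg (fun A => (Perm.sign τ : R) * Matrix.det A) ?_)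
      (sign_mul_det_submatrix_id _ τ)
    ext r i
    rcases eq_or_ne i a with rfl | hi
    · simp [hτ]
    · have hτi : τ i ≠ a := fun hi' => hi (τ.injective (hi'.trans hτ.symm))
      simp [hi, hτi]
  · rw [Matrix.det_eq_zero_of_column_eq_zero a, mul_zero]
    intro r
    simp only [Matrix.of_apply, Function.update_self]
    exact hB' r _ hτ

end PairPermutations

section VandermondeChain

open Polynomial

variable {M J : ℕ}

/-- The position of the member `s` of the `i`-th pair, for `x = (i, s)`, in a list of `J` pairs
followed by `M` unpaired entries. -/
def pairIdx (M : ℕ) (x : Fin J × Fin 2) : Fin (M + 2 * J) := ⟨2 * x.1 + x.2, by lia⟩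

/-- The position of the `c`-th unpaired entry in a list of `J` pairs followed by `M` unpaired
entries. -/
def lastIdx (J : ℕ) (c : Fin M) : Fin (M + 2 * J) := ⟨2 * J + c, by lia⟩

theorem pairIdx_succ (i : Fin J) (s : Fin 2) :
    pairIdx M (i.succ, s) = (pairIdx M (i, s)).succ.succ :=
  Fin.ext (by simp only [pairIdx, Fin.val_succ]; lia)

theorem lastIdx_zero (c : Fin M) : lastIdx 0 c = c :=
  Fin.ext (by simp only [lastIdx, mul_zero, zero_add])

theorem lastIdx_succ (c : Fin M) : lastIdx (J + 1) c = (lastIdx J c).succ.succ :=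
  Fin.ext (by simp only [lastIdx, Fin.val_succ]; lia)

theorem prod_eq_prod_pairIdx_mul_prod_lastIdx {R : Type*} [CommMonoid R] (f : Fin (M + 2 * J) → R) :
    ∏ r, f r =
      (∏ i, f (pairIdx M (i, 0)) * f (pairIdx M (i, 1))) * ∏ c, f (lastIdx J c) := by
  induction J with
  | zero => simp only [Finset.univ_eq_empty, Finset.prod_empty, one_mul, lastIdx_zero]; rfl
  | succ J ih =>
    have hsucc : ∏ r, f r = f (pairIdx M (0, 0)) * (f (pairIdx M (0, 1)) *
        ∏ r : Fin (M + 2 * J), f (Fin.succ (n := M + 2 * J + 1) r.succ)) := by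
      refine (Fin.prod_univ_succ (n := M + 2 * J + 1) f).trans ?_
      rw [Fin.prod_univ_succ]
      rfl
    rw [hsucc, ih fun r => f (Fin.succ (n := M + 2 * J + 1) r.succ), Fin.prod_univ_succ]
    simp only [pairIdx_succ, lastIdx_succ, mul_assoc]

/-- The roots of `J` quadratic polynomials, listed in pairs and followed by `u`. -/
noncomputable def rootVec (u : Fin M → ℂ) : {J : ℕ} → (Fin J → Fin 2 → ℝ) → Fin (M + 2 * J) → ℂ
  | 0, _ => u
  | J + 1, q => Fin.cons (α := fun _ : Fin (M + 2 * J + 1 + 1) => ℂ) (lowRoot (q 0))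
      (Fin.cons (α := fun _ : Fin (M + 2 * J + 1) => ℂ) (highRoot (q 0))
        (rootVec u fun i => q i.succ))

theorem rootVec_succ_succ (u : Fin M → ℂ) (q : Fin (J + 1) → Fin 2 → ℝ) (r : Fin (M + 2 * J)) :
    rootVec u q r.succ.succ = rootVec u (fun i => q i.succ) r := rfl

theorem rootVec_pairIdx (u : Fin M → ℂ) (q : Fin J → Fin 2 → ℝ) (i : Fin J) (s : Fin 2) :
    rootVec u q (pairIdx M (i, s)) = ![lowRoot (q i), highRoot (q i)] s := by
  induction J with
  | zero => exact i.elim0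
  | succ J ih =>
    refine Fin.cases ?_ (fun i => ?_) i
    · fin_cases s <;> rfl
    · rw [pairIdx_succ, rootVec_succ_succ, ih]

theorem rootVec_lastIdx (u : Fin M → ℂ) (q : Fin J → Fin 2 → ℝ) (c : Fin M) :
    rootVec u q (lastIdx J c) = u c := by
  induction J with
  | zero => rw [lastIdx_zero]; rfl
  | succ J ih => rw [lastIdx_succ, rootVec_succ_succ, ih]

theorem prod_comp_rootVec {R : Type*} [CommMonoid R] (f : Fin (M + 2 * J) → ℂ → R)
    (u : Fin M → ℂ) (q : Fin J → Fin 2 → ℝ) :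
    ∏ r, f r (rootVec u q r) =
      (∏ i, f (pairIdx M (i, 0)) (lowRoot (q i)) * f (pairIdx M (i, 1)) (highRoot (q i))) *
        ∏ c, f (lastIdx J c) (u c) := by
  simp only [prod_eq_prod_pairIdx_mul_prod_lastIdx, rootVec_pairIdx, rootVec_lastIdx,
    Matrix.cons_val_zero, Matrix.cons_val_one]

theorem aeval_prodPoly {w : Fin M → ℝ} {u : Fin M → ℂ}
    (hu : (monicPoly w).map (algebraMap ℝ ℂ) = ∏ c, (X - C (u c))) (q : Fin J → Fin 2 → ℝ)
    (z : ℂ) : aeval z (prodPoly q w) = ∏ r, (z - rootVec u q r) := by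
  have hmap : (prodPoly q w).map (algebraMap ℝ ℂ) = ∏ r, (X - C (rootVec u q r)) := by
    rw [prod_comp_rootVec fun _ a => X - C a, prodPoly, Polynomial.map_mul, Polynomial.map_prod, hu]
    simp only [map_monicPoly_two]
  rw [← eval_map_algebraMap, hmap, eval_prod]
  simp only [eval_sub, eval_X, eval_C]

theorem det_vandermonde_cons {R : Type*} [CommRing R] {n : ℕ} (a : R) (v : Fin n → R) :
    (Matrix.vandermonde (Fin.cons a v : Fin (n + 1) → R)).det =
      (∏ j, (v j - a)) * (Matrix.vandermonde v).det := by
  rw [Matrix.det_vandermonde, Matrix.det_vandermonde, Fin.prod_univ_succ, Fin.prod_Ioi_zero]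
  simp only [Fin.prod_Ioi_succ, Fin.cons_zero, Fin.cons_succ]

theorem det_vandermonde_cons_cons {R : Type*} [CommRing R] {n : ℕ} (a b : R) (v : Fin n → R) :
    (Matrix.vandermonde (Fin.cons a (Fin.cons b v : Fin (n + 1) → R) : Fin (n + 2) → R)).det =
      (b - a) * ((∏ j, (a - v j)) * ∏ j, (b - v j)) * (Matrix.vandermonde v).det := by
  have hswap : (∏ j, (v j - a)) * ∏ j, (v j - b) = (∏ j, (a - v j)) * ∏ j, (b - v j) := by
    rw [← Finset.prod_mul_distrib, ← Finset.prod_mul_distrib]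
    exact Finset.prod_congr rfl fun j _ => by ring
  rw [det_vandermonde_cons, det_vandermonde_cons, Fin.prod_univ_succ, ← hswap]
  simp only [Fin.cons_zero, Fin.cons_succ]
  ring

theorem det_vandermonde_rootVec {w : Fin M → ℝ} {u : Fin M → ℂ}
    (hu : (monicPoly w).map (algebraMap ℝ ℂ) = ∏ c, (X - C (u c))) (q : Fin J → Fin 2 → ℝ) :
    (Matrix.vandermonde (rootVec u q)).det =
      (∏ i, (highRoot (q i) - lowRoot (q i))) * chainResultant w q *
        (Matrix.vandermonde u).det := by
  induction J with
  | zero =>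
    rw [Finset.univ_eq_empty, Finset.prod_empty, chainResultant, Complex.ofReal_one, one_mul,
      one_mul]
    rfl
  | succ J ih =>
    refine (det_vandermonde_cons_cons (lowRoot (q 0)) (highRoot (q 0)) _).trans ?_
    rw [← aeval_prodPoly hu, ← aeval_prodPoly hu, ← ofReal_resultant_monicPoly_two, ih,
      Fin.prod_univ_succ, chainResultant, Complex.ofReal_mul]
    ring

theorem map_monicPoly_of_le_one (hM : M ≤ 1) (w : Fin M → ℝ) :
    (monicPoly w).map (algebraMap ℝ ℂ) = ∏ c, (X - C ((-w c : ℝ) : ℂ)) := by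
  interval_cases M <;> simp [monicPoly, ofFn_eq_sum_monomial, ← C_mul_X_pow_eq_monomial]

theorem det_vandermonde_of_le_one (hM : M ≤ 1) (u : Fin M → ℂ) :
    (Matrix.vandermonde u).det = 1 := by
  interval_cases M <;> simp [Matrix.vandermonde]

end VandermondeChain

section LeibnizExpansion

open Polynomial

variable {M J n : ℕ}

/-- The factor of a term of the Leibniz expansion that belongs to a monic quadratic polynomial. -/
noncomputable def pairDensity (h : ℝ[X] → ℂ) (P Q : ℂ[X]) (q : Fin 2 → ℝ) : ℂ :=
  h (monicPoly q) * (P.eval (lowRoot q) * Q.eval (highRoot q)) / (highRoot q - lowRoot q)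

/-- The factor of a term of the Leibniz expansion that belongs to a monic linear polynomial. -/
noncomputable def lineDensity (h : ℝ[X] → ℂ) (P : ℂ[X]) (x : ℝ) : ℂ :=
  h (X - C x) * P.eval (x : ℂ)

/-- The term of the Leibniz expansion in which the root at position `r` is evaluated at `P r`. -/
noncomputable def leibnizTerm (h : ℝ[X] → ℂ) (P : Fin (M + 2 * J) → ℂ[X])
    (p : (Fin J → Fin 2 → ℝ) × (Fin M → ℝ)) : ℂ :=
  (∏ i, pairDensity h (P (pairIdx M (i, 0))) (P (pairIdx M (i, 1))) (p.1 i)) *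
    ∏ c, lineDensity h (P (lastIdx J c)) (-p.2 c)

theorem integrable_leibnizTerm {h : ℝ[X] → ℂ} {P : Fin (M + 2 * J) → ℂ[X]}
    (hB : ∀ j k, Integrable (pairDensity h (P j) (P k)))
    (hL : ∀ j, Integrable (lineDensity h (P j))) :
    Integrable (leibnizTerm h P) :=
  (Integrable.fintype_prod fun _ => hB _ _).mul_prod
    (Integrable.fintype_prod fun _ => (hL _).comp_neg)

theorem integral_leibnizTerm (h : ℝ[X] → ℂ) (P : Fin (M + 2 * J) → ℂ[X]) :
    ∫ p, leibnizTerm h P p =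
      (∏ i, ∫ q, pairDensity h (P (pairIdx M (i, 0))) (P (pairIdx M (i, 1))) q) *
        ∏ c, ∫ x, lineDensity h (P (lastIdx J c)) x := by
  refine (integral_prod_mul (μ := (volume : Measure (Fin J → Fin 2 → ℝ)))
    (ν := (volume : Measure (Fin M → ℝ))) (fun q => ∏ i, pairDensity h (P (pairIdx M (i, 0)))
      (P (pairIdx M (i, 1))) (q i)) fun w => ∏ c, lineDensity h (P (lastIdx J c)) (-w c)).trans ?_
  rw [integral_fintype_prod_volume_eq_prod,
    integral_fintype_prod_volume_eq_prod (f := fun c x => lineDensity h (P (lastIdx J c)) (-x))]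
  exact congrArg _ (Finset.prod_congr rfl fun c _ => integral_neg_eq_self _ volume)

theorem ae_forall_quadDisc_ne_zero :
    ∀ᵐ p : (Fin J → Fin 2 → ℝ) × (Fin M → ℝ), ∀ i, quadDisc (p.1 i) ≠ 0 :=
  ae_all_iff.2 fun i =>
    ((Measure.quasiMeasurePreserving_eval (fun _ : Fin J => (volume : Measure (Fin 2 → ℝ)))
      i).comp Measure.quasiMeasurePreserving_fst).ae ae_quadDisc_ne_zero

theorem comp_prodPoly_of_le_one {N : Type*} [CommMonoid N] (hM : M ≤ 1) (h : ℝ[X] →* N)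
    (q : Fin J → Fin 2 → ℝ) (w : Fin M → ℝ) :
    h (prodPoly q w) = (∏ i, h (monicPoly (q i))) * ∏ c, h (X - C (-w c)) := by
  have hlinear : monicPoly w = ∏ c, (X - C (-w c)) := by
    refine Polynomial.map_injective _ (algebraMap ℝ ℂ).injective ?_
    simp only [map_monicPoly_of_le_one hM, Polynomial.map_prod, Polynomial.map_sub, map_X, map_C,
      Complex.coe_algebraMap]
  rw [prodPoly, map_mul, map_prod, hlinear, map_prod]

theorem chainResultant_mul_comp_prodPoly (hM : M ≤ 1) (h : ℝ[X] →* ℂ)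
    {P : Fin (M + 2 * J) → ℂ[X]} (hP : ∀ i, (P i).Monic) (hPd : ∀ i, (P i).natDegree = i)
    {q : Fin J → Fin 2 → ℝ} (hq : ∀ i, quadDisc (q i) ≠ 0) (w : Fin M → ℝ) :
    chainResultant w q * h (prodPoly q w) =
      ∑ σ : Equiv.Perm (Fin (M + 2 * J)), (Equiv.Perm.sign σ : ℂ) *
        leibnizTerm h (P ∘ σ) (q, w) := by
  have hroots : ∏ i, (highRoot (q i) - lowRoot (q i)) ≠ 0 := Finset.prod_ne_zero_iff.2 fun i _ =>
    sub_ne_zero.2 fun heq => hq i ((quadDisc_eq_zero_iff _).2 heq.symm)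
  have hV := det_vandermonde_rootVec (map_monicPoly_of_le_one hM w) q
  rw [det_vandermonde_of_le_one hM, mul_one,
    Matrix.det_eval_matrixOfPolynomials_eq_det_vandermonde _ P hPd hP, ← Matrix.det_transpose,
    Matrix.det_apply'] at hV
  refine mul_left_cancel₀ hroots ?_
  rw [← mul_assoc, ← hV, Finset.sum_mul, Finset.mul_sum]
  refine Finset.sum_congr rfl fun σ _ => ?_
  simp only [Matrix.transpose_apply, Matrix.of_apply]
  rw [prod_comp_rootVec fun r a => (P (σ r)).eval a, comp_prodPoly_of_le_one hM]
  simp only [leibnizTerm, pairDensity, lineDensity, Function.comp_apply, Finset.prod_div_distrib,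
    Finset.prod_mul_distrib]
  field_simp

theorem factorial_mul_integral_eq_sum (hM : M ≤ 1) (h : ℝ[X] →* ℂ) (hn : n = 2 * J + M)
    (hm : StronglyMeasurable fun b : Fin n → ℝ => h (monicPoly b))
    (hi : Integrable fun b : Fin n → ℝ => h (monicPoly b))
    {P : Fin (M + 2 * J) → ℂ[X]} (hP : ∀ i, (P i).Monic) (hPd : ∀ i, (P i).natDegree = i)
    (hB : ∀ j k, Integrable (pairDensity h (P j) (P k)))
    (hL : ∀ j, Integrable (lineDensity h (P j))) :
    (J.factorial : ℂ) * ∫ b : Fin n → ℝ, h (monicPoly b) =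
      ∑ σ : Equiv.Perm (Fin (M + 2 * J)), (Equiv.Perm.sign σ : ℂ) *
        ((∏ i, ∫ q, pairDensity h (P (σ (pairIdx M (i, 0)))) (P (σ (pairIdx M (i, 1)))) q) *
          ∏ c, ∫ x, lineDensity h (P (σ (lastIdx J c))) x) := by
  have hterm (σ : Equiv.Perm (Fin (M + 2 * J))) : Integrable (leibnizTerm h (P ∘ σ)) :=
    integrable_leibnizTerm (fun _ _ => hB _ _) fun _ => hL _
  have htransfer := (transfersIntegral_chainResultant_smul hn hm hi).integral_eq
  rw [Nat.div_eq_of_lt (Nat.lt_succ_of_le hM), zero_add, Nat.one_ascFactorial] at htransfer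
  calc (J.factorial : ℂ) * ∫ b : Fin n → ℝ, h (monicPoly b)
      = ∫ p : (Fin J → Fin 2 → ℝ) × (Fin M → ℝ),
        chainResultant p.2 p.1 • h (prodPoly p.1 p.2) := by
        rw [htransfer, Complex.real_smul, Complex.ofReal_natCast]
    _ = ∫ p, ∑ σ : Equiv.Perm (Fin (M + 2 * J)), (Equiv.Perm.sign σ : ℂ) *
          leibnizTerm h (P ∘ σ) p :=
        integral_congr_ae (ae_forall_quadDisc_ne_zero.mono fun p hp =>
          chainResultant_mul_comp_prodPoly hM h hP hPd hp p.2)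
    _ = ∑ σ : Equiv.Perm (Fin (M + 2 * J)), (Equiv.Perm.sign σ : ℂ) *
          ∫ p, leibnizTerm h (P ∘ σ) p := by
        rw [integral_finsetSum _ fun σ _ => (hterm σ).const_mul _]
        simp only [integral_const_mul]
    _ = _ := by simp only [integral_leibnizTerm, Function.comp_apply]

end LeibnizExpansion

section Checkerboard

open Equiv Finset

variable {R : Type*} [CommRing R] {J : ℕ}

/-- The positions in a list of pairs, with no entry left unpaired, as an equivalence. -/
def pairIdxEquiv (J : ℕ) : Fin J × Fin 2 ≃ Fin (0 + 2 * J) :=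
  finProdFinEquiv.trans (finCongr (by lia))

theorem pairIdxEquiv_apply (x : Fin J × Fin 2) : pairIdxEquiv J x = pairIdx 0 x :=
  Fin.ext (add_comm (x.2 : ℕ) (2 * x.1))

theorem sum_perm_pairs_even [NoZeroDivisors R] [NeZero (2 : R)]
    {B : Fin (0 + 2 * J) → Fin (0 + 2 * J) → R}
    (h : ∀ j k : Fin (0 + 2 * J), (j : ℕ) % 2 = k % 2 → B j k = B k j) :
    ∑ σ : Perm (Fin (0 + 2 * J)), (Perm.sign σ : R) *
        ∏ i, B (σ (pairIdx 0 (i, 0))) (σ (pairIdx 0 (i, 1))) =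
      J.factorial * (Matrix.of fun r i : Fin J =>
        B (pairIdx 0 (r, 0)) (pairIdx 0 (i, 1)) - B (pairIdx 0 (i, 1)) (pairIdx 0 (r, 0))).det := by
  have hpairs := pairSum_const (α := Fin J) (B := fun x y => B (pairIdx 0 x) (pairIdx 0 y))
    fun j k s => h _ _ (by simp only [pairIdx]; lia)
  rw [Fintype.card_fin] at hpairs
  rw [← hpairs, pairSum, ← Equiv.sum_comp (pairIdxEquiv J).permCongr]
  refine sum_congr rfl fun σ _ => ?_
  simp only [Perm.sign_permCongr, permCongr_apply, ← pairIdxEquiv_apply, symm_apply_apply]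

theorem sum_perm_option {β : Type*} [Fintype β] [DecidableEq β] (f : Perm (Option β) → R)
    (hf : ∀ ρ, ρ none ≠ none → f ρ = 0) :
    ∑ ρ : Perm (Option β), f ρ = ∑ σ : Perm β, f (optionCongr σ) := by
  rw [← Equiv.sum_comp (Perm.decomposeOption (α := β)).symm, Fintype.sum_prod_type,
    sum_eq_single none]
  · refine sum_congr rfl fun σ _ => congrArg f ?_
    ext1 x
    simp
  · intro x _ hx
    refine sum_eq_zero fun σ _ => hf _ ?_
    simpa using hx
  · simp

/-- The pairing of `none` with the last of the `2 * J + 1` indices, and of the other indices as in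
`pairIdx`. -/
def optionPairEquiv (J : ℕ) : Fin (J + 1) × Fin 2 ≃ Option (Fin (1 + 2 * J)) :=
  (finProdFinEquiv.trans (finCongr (by lia))).trans finSuccEquivLast

theorem optionPairEquiv_of_lt {x : Fin (J + 1) × Fin 2} (hx : 2 * (x.1 : ℕ) + x.2 < 1 + 2 * J) :
    optionPairEquiv J x = some ⟨2 * x.1 + x.2, hx⟩ := by
  have hcast : finCongr (by lia) (finProdFinEquiv x) =
      (⟨2 * x.1 + x.2, hx⟩ : Fin (1 + 2 * J)).castSucc :=
    Fin.ext (add_comm (x.2 : ℕ) (2 * x.1))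
  exact (congrArg finSuccEquivLast hcast).trans (finSuccEquivLast_castSucc _)

theorem optionPairEquiv_castSucc (i : Fin J) (s : Fin 2) :
    optionPairEquiv J (i.castSucc, s) = some (pairIdx 1 (i, s)) :=
  optionPairEquiv_of_lt _

theorem optionPairEquiv_last_zero :
    optionPairEquiv J (Fin.last J, 0) = some (lastIdx J 0) :=
  optionPairEquiv_of_lt _

theorem optionPairEquiv_last_one : optionPairEquiv J (Fin.last J, 1) = none := by
  have hcast : finCongr (by lia) (finProdFinEquiv (Fin.last J, (1 : Fin 2))) =
      Fin.last (1 + 2 * J) := Fin.ext rfl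
  exact (congrArg finSuccEquivLast hcast).trans finSuccEquivLast_last

/-- Extension of a bilinear table by zero to an additional index. -/
def extendZero {β : Type*} (B : β → β → R) : Option β → Option β → R
  | some j, some k => B j k
  | _, _ => 0

/-- The table of the pairings of `L` with an additional index. -/
def extendLinear {β : Type*} (L : β → R) : Option β → Option β → R
  | some j, none => L j
  | _, _ => 0

/-- The table, over `J + 1` pairs, whose pairs are weighted by `B`, except for the last one, which
weights its first entry by `L` if its second one is the additional index. -/
def oddTable (B : Fin (1 + 2 * J) → Fin (1 + 2 * J) → R) (L : Fin (1 + 2 * J) → R) :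
    Fin (J + 1) → Fin (J + 1) × Fin 2 → Fin (J + 1) × Fin 2 → R :=
  Function.update (fun _ x y => extendZero B (optionPairEquiv J x) (optionPairEquiv J y))
    (Fin.last J) fun x y => extendLinear L (optionPairEquiv J x) (optionPairEquiv J y)

theorem pairSum_oddTable (B : Fin (1 + 2 * J) → Fin (1 + 2 * J) → R) (L : Fin (1 + 2 * J) → R) :
    pairSum (oddTable B L) = ∑ σ : Perm (Fin (1 + 2 * J)), (Perm.sign σ : R) *
      ((∏ i, B (σ (pairIdx 1 (i, 0))) (σ (pairIdx 1 (i, 1)))) * L (σ (lastIdx J 0))) := by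
  rw [pairSum, ← Equiv.sum_comp (optionPairEquiv J).symm.permCongr, sum_perm_option]
  · refine sum_congr rfl fun σ _ => ?_
    simp only [Fin.prod_univ_castSucc, oddTable, Function.update_self,
      Function.update_of_ne (Fin.castSucc_lt_last _).ne, Perm.sign_permCongr, optionCongr_sign,
      permCongr_apply, symm_symm, apply_symm_apply, optionPairEquiv_castSucc,
      optionPairEquiv_last_zero, optionPairEquiv_last_one, optionCongr_apply, Option.map_some,
      Option.map_none, extendZero, extendLinear]
  · intro ρ hρ
    obtain ⟨k, hk⟩ := Option.ne_none_iff_exists'.1 hρ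
    have hlast (x : Option (Fin (1 + 2 * J))) : extendLinear L x (ρ none) = 0 := by
      rw [hk]
      cases x <;> rfl
    simp only [Fin.prod_univ_castSucc, oddTable, Function.update_self, permCongr_apply, symm_symm,
      apply_symm_apply, optionPairEquiv_last_one, hlast, mul_zero]

theorem eq_some_or_eq_none_of_optionPairEquiv (i : Fin (J + 1)) (s : Fin 2) :
    (∃ a : Fin (1 + 2 * J), (a : ℕ) % 2 = s ∧ optionPairEquiv J (i, s) = some a) ∨
      s = 1 ∧ optionPairEquiv J (i, s) = none := by
  by_cases hx : 2 * (i : ℕ) + s < 1 + 2 * J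
  · exact Or.inl ⟨⟨2 * i + s, hx⟩, by simp only; lia, optionPairEquiv_of_lt hx⟩
  · obtain ⟨rfl, rfl⟩ : i = Fin.last J ∧ s = 1 := by
      simp only [Fin.ext_iff, Fin.val_last]
      lia
    exact Or.inr ⟨rfl, optionPairEquiv_last_one⟩

theorem extendZero_comm {B : Fin (1 + 2 * J) → Fin (1 + 2 * J) → R}
    (h : ∀ j k : Fin (1 + 2 * J), (j : ℕ) % 2 = k % 2 → B j k = B k j) (j k : Fin (J + 1))
    (s : Fin 2) :
    extendZero B (optionPairEquiv J (j, s)) (optionPairEquiv J (k, s)) =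
      extendZero B (optionPairEquiv J (k, s)) (optionPairEquiv J (j, s)) := by
  rcases eq_some_or_eq_none_of_optionPairEquiv j s with ⟨a, ha, hj⟩ | ⟨-, hj⟩ <;>
    rcases eq_some_or_eq_none_of_optionPairEquiv k s with ⟨b, hb, hk⟩ | ⟨-, hk⟩ <;>
    rw [hj, hk]
  exacts [h a b (ha.trans hb.symm), rfl, rfl]

theorem extendLinear_eq_zero {L : Fin (1 + 2 * J) → R}
    (hL : ∀ j : Fin (1 + 2 * J), (j : ℕ) % 2 = 1 → L j = 0) (j k : Fin (J + 1)) (s : Fin 2) :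
    extendLinear L (optionPairEquiv J (j, s)) (optionPairEquiv J (k, s)) = 0 := by
  rcases eq_some_or_eq_none_of_optionPairEquiv j s with ⟨a, ha, hj⟩ | ⟨-, hj⟩ <;>
    rcases eq_some_or_eq_none_of_optionPairEquiv k s with ⟨b, -, hk⟩ | ⟨rfl, hk⟩ <;>
    rw [hj, hk]
  exacts [rfl, hL a ha, rfl, rfl]

theorem optionPairEquiv_zero (r : Fin (J + 1)) :
    optionPairEquiv J (r, 0) = some ⟨2 * r, by lia⟩ :=
  optionPairEquiv_of_lt (x := (r, 0)) (by simp only [Fin.val_zero]; lia)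

theorem optionPairEquiv_one {i : Fin (J + 1)} (hi : (i : ℕ) < J) :
    optionPairEquiv J (i, 1) = some ⟨2 * i + 1, by lia⟩ :=
  optionPairEquiv_of_lt (x := (i, 1)) (by simp only [Fin.val_one]; lia)

theorem oddTable_sub_swap (B : Fin (1 + 2 * J) → Fin (1 + 2 * J) → R) (L : Fin (1 + 2 * J) → R)
    (r i : Fin (J + 1)) :
    oddTable B L i (r, 0) (i, 1) - oddTable B L i (i, 1) (r, 0) =
      if hi : (i : ℕ) < J then
        B ⟨2 * r, by lia⟩ ⟨2 * i + 1, by lia⟩ - B ⟨2 * i + 1, by lia⟩ ⟨2 * r, by lia⟩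
      else L ⟨2 * r, by lia⟩ := by
  split_ifs with hi
  · have hne : i ≠ Fin.last J := fun h => hi.ne (congrArg Fin.val h)
    simp only [oddTable, Function.update_of_ne hne, optionPairEquiv_zero, optionPairEquiv_one hi,
      extendZero]
  · obtain rfl : i = Fin.last J := Fin.ext (by rw [Fin.val_last]; lia)
    simp only [oddTable, Function.update_self, optionPairEquiv_zero, optionPairEquiv_last_one,
      extendLinear, sub_zero]

theorem sum_perm_pairs_odd [NoZeroDivisors R] [NeZero (2 : R)]
    {B : Fin (1 + 2 * J) → Fin (1 + 2 * J) → R} {L : Fin (1 + 2 * J) → R}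
    (h : ∀ j k : Fin (1 + 2 * J), (j : ℕ) % 2 = k % 2 → B j k = B k j)
    (hL : ∀ j : Fin (1 + 2 * J), (j : ℕ) % 2 = 1 → L j = 0) :
    ∑ σ : Perm (Fin (1 + 2 * J)), (Perm.sign σ : R) *
        ((∏ i, B (σ (pairIdx 1 (i, 0))) (σ (pairIdx 1 (i, 1)))) * L (σ (lastIdx J 0))) =
      J.factorial * (Matrix.of fun r i : Fin (J + 1) =>
        if hi : (i : ℕ) < J then
          B ⟨2 * r, by lia⟩ ⟨2 * i + 1, by lia⟩ - B ⟨2 * i + 1, by lia⟩ ⟨2 * r, by lia⟩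
        else L ⟨2 * r, by lia⟩).det := by
  have hlinear (r k : Fin (J + 1)) (hk : k ≠ Fin.last J) :
      extendLinear L (optionPairEquiv J (r, 0)) (optionPairEquiv J (k, 1)) -
        extendLinear L (optionPairEquiv J (k, 1)) (optionPairEquiv J (r, 0)) = 0 := by
    rw [optionPairEquiv_zero, optionPairEquiv_one (Fin.val_lt_last hk)]
    exact sub_zero 0
  have hpairs := pairSum_update (Fin.last J)
    (B := fun x y => extendZero B (optionPairEquiv J x) (optionPairEquiv J y))
    (B' := fun x y => extendLinear L (optionPairEquiv J x) (optionPairEquiv J y))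
    (extendZero_comm h) (fun j k s =>
      (extendLinear_eq_zero hL j k s).trans (extendLinear_eq_zero hL k j s).symm) hlinear
  rw [Fintype.card_fin, Nat.add_sub_cancel] at hpairs
  rw [← pairSum_oddTable]
  refine hpairs.trans (congrArg (fun A => (J.factorial : R) * Matrix.det A) ?_)
  ext r i
  exact oddTable_sub_swap B L r i

end Checkerboard

section Bounds

open Polynomial
open scoped ComplexConjugate

theorem exists_pos_mul_norm_le {E : Type*} [NormedAddCommGroup E] [NormedSpace ℝ E]
    [ProperSpace E] {f : E → ℝ} (hf : Continuous f)
    (hsmul : ∀ (r : ℝ) (x : E), 0 ≤ r → f (r • x) = r * f x) (hpos : ∀ x ≠ 0, 0 < f x) :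
    ∃ c > 0, ∀ x, c * ‖x‖ ≤ f x := by
  have hzero : f 0 = 0 := by simpa using hsmul 0 0 le_rfl
  obtain ⟨c, hc, hmin⟩ : ∃ c > 0, ∀ u ∈ Metric.sphere (0 : E) 1, c ≤ f u := by
    rcases (Metric.sphere (0 : E) 1).eq_empty_or_nonempty with h | h
    · exact ⟨1, one_pos, by simp [h]⟩
    · obtain ⟨u, hu, hmin⟩ := (isCompact_sphere (0 : E) 1).exists_isMinOn h hf.continuousOn
      exact ⟨f u, hpos u (ne_zero_of_mem_unit_sphere ⟨u, hu⟩), hmin⟩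
  refine ⟨c, hc, fun x => ?_⟩
  rcases eq_or_ne x 0 with rfl | hx
  · simp [hzero]
  calc c * ‖x‖ ≤ f (‖x‖⁻¹ • x) * ‖x‖ := by
        gcongr
        exact hmin _ (mem_sphere_zero_iff_norm.2 (norm_smul_inv_norm (𝕜 := ℝ) hx))
    _ = f x := by
        rw [hsmul _ _ (by positivity), mul_right_comm, inv_mul_cancel₀ (norm_ne_zero_iff.2 hx),
          one_mul]

theorem continuous_cpow_neg {Y : Type*} [TopologicalSpace Y] {F : Y → ℝ} (hF : Continuous F)
    (hpos : ∀ y, 0 < F y) (s : ℂ) : Continuous fun y => (F y : ℂ) ^ (-s) :=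
  (Complex.continuous_ofReal.comp hF).cpow continuous_const fun y =>
    Complex.ofReal_mem_slitPlane.2 (hpos y)

theorem norm_cpow_neg_le {c r y : ℝ} {s : ℂ} (hs : 0 ≤ s.re) (hc : 0 < c) (hr : 0 < r)
    (h : c * r ≤ y) : ‖(y : ℂ) ^ (-s)‖ ≤ c ^ (-s.re) * r ^ (-s.re) := by
  have hcr : 0 < c * r := mul_pos hc hr
  rw [Complex.norm_cpow_eq_rpow_re_of_pos (hcr.trans_le h), Complex.neg_re,
    ← Real.mul_rpow hc.le hr.le]
  exact Real.rpow_le_rpow_of_nonpos hcr h (neg_nonpos.2 hs)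

theorem integrable_of_norm_le_one_add_norm_rpow {E F : Type*} [NormedAddCommGroup E]
    [NormedSpace ℝ E] [FiniteDimensional ℝ E] [MeasurableSpace E] [BorelSpace E]
    [NormedAddCommGroup F] {μ : Measure E} [μ.IsAddHaarMeasure] {f : E → F} {K r : ℝ}
    (hf : Continuous f) (hr : Module.finrank ℝ E < r) (hle : ∀ x, ‖f x‖ ≤ K * (1 + ‖x‖) ^ (-r)) :
    Integrable f μ :=
  ((integrable_one_add_norm hr).const_mul K).mono' hf.aestronglyMeasurable (ae_of_all _ hle)

theorem exists_norm_eval_le (P : ℂ[X]) :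
    ∃ K, ∀ z, ‖P.eval z‖ ≤ K * (1 + ‖z‖) ^ P.natDegree := by
  refine ⟨∑ i ∈ Finset.range (P.natDegree + 1), ‖P.coeff i‖, fun z => ?_⟩
  rw [eval_eq_sum_range, Finset.sum_mul]
  refine (norm_sum_le _ _).trans (Finset.sum_le_sum fun i hi => ?_)
  rw [norm_mul, norm_pow]
  gcongr
  calc ‖z‖ ^ i ≤ (1 + ‖z‖) ^ i := by gcongr; exact le_add_of_nonneg_left zero_le_one
    _ ≤ (1 + ‖z‖) ^ P.natDegree :=
      pow_le_pow_right₀ (le_add_of_nonneg_right (norm_nonneg z)) (Finset.mem_range_succ_iff.1 hi)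

variable {N : ℕ}

theorem monicPoly_eq_ofFn_snoc (b : Fin N → ℂ) :
    monicPoly b = ofFn (N + 1) (Fin.snoc b 1 : Fin (N + 1) → ℂ) := by
  rw [monicPoly, ofFn_eq_sum_monomial, ofFn_eq_sum_monomial, Fin.sum_univ_castSucc, add_comm,
    X_pow_eq_monomial]
  simp only [Fin.snoc_castSucc, Fin.snoc_last, Fin.val_castSucc, Fin.val_last]

theorem map_monicPoly (b : Fin N → ℝ) :
    (monicPoly b).map (algebraMap ℝ ℂ) = monicPoly fun i => (b i : ℂ) := by
  simp only [monicPoly, ofFn_eq_sum_monomial, Polynomial.map_add, Polynomial.map_pow, map_X,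
    Polynomial.map_sum, map_monomial, Complex.coe_algebraMap]

variable {Φ : ℂ[X] → ℝ}

theorem rootFunction_eq_monicPoly (z : ℂ) :
    rootFunction Φ z = Φ (monicPoly fun _ : Fin 1 => -z) := by
  rw [rootFunction, monicPoly, ofFn_eq_sum_monomial, Fin.sum_univ_one, sub_eq_add_neg, ← C_neg]
  simp only [pow_one, Fin.val_zero, monomial_zero_left]

namespace IsMultiplicativeDistance

theorem map_one (hΦ : IsMultiplicativeDistance Φ) : Φ 1 = 1 := by
  have h1 : Φ 1 ≠ 0 := fun h => one_ne_zero ((hΦ.eq_zero_iff 1).1 h)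
  refine mul_left_cancel₀ h1 ?_
  rw [← hΦ.map_mul, mul_one, mul_one]

theorem pos (hΦ : IsMultiplicativeDistance Φ) {f : ℂ[X]} (hf : f ≠ 0) : 0 < Φ f :=
  (hΦ.nonneg f).lt_of_ne fun h => hf ((hΦ.eq_zero_iff f).1 h.symm)

theorem continuous_comp_ofFn (hΦ : IsMultiplicativeDistance Φ) (n : ℕ) :
    Continuous fun a : Fin n → ℂ => Φ (ofFn n a) := by
  simpa only [ofFn_eq_sum_monomial, C_mul_X_pow_eq_monomial] using hΦ.continuous n

theorem exists_pos_mul_norm_le_ofFn (hΦ : IsMultiplicativeDistance Φ) (n : ℕ) :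
    ∃ c > 0, ∀ a : Fin n → ℂ, c * ‖a‖ ≤ Φ (ofFn n a) := by
  refine exists_pos_mul_norm_le (hΦ.continuous_comp_ofFn n) (fun r a hr => ?_) fun a ha =>
    hΦ.pos fun h => ha (injective_ofFn n (h.trans (ofFn_zero n).symm))
  rw [← Complex.coe_smul, map_smul, smul_eq_C_mul, hΦ.homogeneous, Complex.norm_of_nonneg hr]

theorem continuous_comp_monicPoly (hΦ : IsMultiplicativeDistance Φ) (N : ℕ) :
    Continuous fun b : Fin N → ℂ => Φ (monicPoly b) := by
  simp only [monicPoly_eq_ofFn_snoc]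
  exact (hΦ.continuous_comp_ofFn (N + 1)).comp
    (Continuous.finSnoc (A := fun _ => ℂ) continuous_id continuous_const)

theorem exists_pos_mul_one_add_norm_le (hΦ : IsMultiplicativeDistance Φ) (N : ℕ) :
    ∃ c > 0, ∀ b : Fin N → ℂ, c * (1 + ‖b‖) ≤ Φ (monicPoly b) := by
  obtain ⟨c, hc, hle⟩ := hΦ.exists_pos_mul_norm_le_ofFn (N + 1)
  refine ⟨c / 2, half_pos hc, fun b => ?_⟩
  rw [monicPoly_eq_ofFn_snoc]
  set a : Fin (N + 1) → ℂ := Fin.snoc b 1 with ha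
  have hone : 1 ≤ ‖a‖ := by simpa [ha] using norm_le_pi_norm a (Fin.last N)
  have hb : ‖b‖ ≤ ‖a‖ := (pi_norm_le_iff_of_nonneg (norm_nonneg a)).2 fun i => by
    simpa [ha] using norm_le_pi_norm a i.castSucc
  calc c / 2 * (1 + ‖b‖) ≤ c / 2 * (‖a‖ + ‖a‖) := by gcongr
    _ = c * ‖a‖ := by ring
    _ ≤ _ := hle a

end IsMultiplicativeDistance

/-- The weight `f ↦ Φ(f)^(-s)` of the moment function, as a multiplicative function on real
polynomials. -/
noncomputable def weight (hΦ : IsMultiplicativeDistance Φ) (s : ℂ) : ℝ[X] →* ℂ where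
  toFun f := (Φ (f.map (algebraMap ℝ ℂ)) : ℂ) ^ (-s)
  map_one' := by simp [hΦ.map_one]
  map_mul' f g := by
    rw [Polynomial.map_mul, hΦ.map_mul, Complex.ofReal_mul,
      Complex.mul_cpow_ofReal_nonneg (hΦ.nonneg _) (hΦ.nonneg _)]

theorem weight_apply (hΦ : IsMultiplicativeDistance Φ) (s : ℂ) (f : ℝ[X]) :
    weight hΦ s f = (Φ (f.map (algebraMap ℝ ℂ)) : ℂ) ^ (-s) := rfl

theorem continuous_weight_monicPoly (hΦ : IsMultiplicativeDistance Φ) (s : ℂ) (N : ℕ) :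
    Continuous fun b : Fin N → ℝ => weight hΦ s (monicPoly b) := by
  simp only [weight_apply, map_monicPoly]
  exact continuous_cpow_neg ((hΦ.continuous_comp_monicPoly N).comp (by fun_prop))
    (fun b => hΦ.pos (monic_monicPoly _).ne_zero) s

theorem integrable_weight_monicPoly (hΦ : IsMultiplicativeDistance Φ) {s : ℂ}
    (hs : (N : ℝ) < s.re) : Integrable fun b : Fin N → ℝ => weight hΦ s (monicPoly b) := by
  obtain ⟨c, hc, hle⟩ := hΦ.exists_pos_mul_one_add_norm_le N
  refine integrable_of_norm_le_one_add_norm_rpow (K := c ^ (-s.re)) (r := s.re)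
    (continuous_weight_monicPoly hΦ s N) (by rwa [Module.finrank_fin_fun]) fun b => ?_
  have hb : ‖fun i => (b i : ℂ)‖ = ‖b‖ := by simp only [Pi.norm_def, Complex.nnnorm_real]
  rw [weight_apply, map_monicPoly]
  refine norm_cpow_neg_le ((Nat.cast_nonneg N).trans hs.le) hc (by positivity) ?_
  rw [← hb]
  exact hle _

theorem momentIntegrand_eq_weight (hΦ : IsMultiplicativeDistance Φ) (s : ℂ) (b : Fin N → ℝ) :
    momentIntegrand Φ N s b = weight hΦ s (monicPoly fun i => b i.rev) := by
  rw [momentIntegrand, monicRestriction, weight_apply, map_monicPoly, monicPoly,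
    ofFn_eq_sum_monomial, ← Equiv.sum_comp Fin.revPerm]
  simp only [← C_mul_X_pow_eq_monomial, Fin.revPerm_apply, Fin.val_rev]
  congr! 9
  lia

theorem measurePreserving_rev (N : ℕ) : MeasurePreserving
    (MeasurableEquiv.arrowCongr' (Fin.revPerm (n := N)) (MeasurableEquiv.refl ℝ)) :=
  volume_preserving_arrowCongr' _ _ (MeasurePreserving.id _)

theorem momentIntegrand_eq_comp_rev (hΦ : IsMultiplicativeDistance Φ) (s : ℂ) :
    momentIntegrand Φ N s = (fun b => weight hΦ s (monicPoly b)) ∘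
      MeasurableEquiv.arrowCongr' (Fin.revPerm (n := N)) (MeasurableEquiv.refl ℝ) :=
  funext (momentIntegrand_eq_weight hΦ s)

theorem integrable_momentIntegrand (hΦ : IsMultiplicativeDistance Φ) {s : ℂ}
    (hs : (N : ℝ) < s.re) : Integrable (momentIntegrand Φ N s) := by
  rw [momentIntegrand_eq_comp_rev hΦ]
  exact ((measurePreserving_rev N).integrable_comp_emb
    (MeasurableEquiv.measurableEmbedding _)).2 (integrable_weight_monicPoly hΦ hs)

theorem momentFunction_eq_integral_weight (hΦ : IsMultiplicativeDistance Φ) (s : ℂ) (N : ℕ) :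
    momentFunction Φ N s = ∫ b : Fin N → ℝ, weight hΦ s (monicPoly b) := by
  rw [momentFunction, momentIntegrand_eq_comp_rev hΦ]
  exact (measurePreserving_rev N).integral_comp' fun b => weight hΦ s (monicPoly b)

/-- The function `φ(z)^(-s) P(z)` on the complex plane, whose restriction to the real line is
`lineIntegrand`. -/
noncomputable def rootWeight (Φ : ℂ[X] → ℝ) (s : ℂ) (P : ℂ[X]) (z : ℂ) : ℂ :=
  (rootFunction Φ z : ℂ) ^ (-s) * P.eval z

theorem continuous_rootWeight (hΦ : IsMultiplicativeDistance Φ) (s : ℂ) (P : ℂ[X]) :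
    Continuous (rootWeight Φ s P) := by
  have hφ : Continuous (rootFunction Φ) := by
    rw [funext rootFunction_eq_monicPoly]
    exact (hΦ.continuous_comp_monicPoly 1).comp (by fun_prop)
  exact (continuous_cpow_neg hφ (fun z => hΦ.pos (X_sub_C_ne_zero z)) s).mul P.continuous

theorem exists_norm_rootWeight_le (hΦ : IsMultiplicativeDistance Φ) {s : ℂ} (hs : 0 ≤ s.re)
    (P : ℂ[X]) : ∃ K, ∀ z, ‖rootWeight Φ s P z‖ ≤ K * (1 + ‖z‖) ^ (-(s.re - P.natDegree)) := by
  obtain ⟨c, hc, hle⟩ := hΦ.exists_pos_mul_one_add_norm_le 1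
  obtain ⟨K, hP⟩ := exists_norm_eval_le P
  refine ⟨c ^ (-s.re) * K, fun z => ?_⟩
  have hφ : ‖(rootFunction Φ z : ℂ) ^ (-s)‖ ≤ c ^ (-s.re) * (1 + ‖z‖) ^ (-s.re) := by
    refine norm_cpow_neg_le hs hc (by positivity) ?_
    simpa [rootFunction_eq_monicPoly, pi_norm_const] using hle fun _ => -z
  calc ‖rootWeight Φ s P z‖
      ≤ (c ^ (-s.re) * (1 + ‖z‖) ^ (-s.re)) * (K * (1 + ‖z‖) ^ P.natDegree) := by
        rw [rootWeight, norm_mul]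
        exact mul_le_mul hφ (hP z) (norm_nonneg _) (by positivity)
    _ = c ^ (-s.re) * K * (1 + ‖z‖) ^ (-(s.re - P.natDegree)) := by
        rw [neg_sub, sub_eq_add_neg, Real.rpow_add (by positivity), Real.rpow_natCast]
        ring

variable {s : ℂ} {P Q : ℂ[X]}

theorem integrable_lineIntegrand (hΦ : IsMultiplicativeDistance Φ)
    (hP : (P.natDegree : ℝ) + 1 < s.re) : Integrable (lineIntegrand Φ s P) := by
  obtain ⟨K, hK⟩ := exists_norm_rootWeight_le hΦ (s := s) (by grind) P
  refine integrable_of_norm_le_one_add_norm_rpow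
    ((continuous_rootWeight hΦ s P).comp Complex.continuous_ofReal) (K := K)
    (r := s.re - P.natDegree) ?_ fun x => ?_
  · rw [Module.finrank_self, Nat.cast_one]
    linarith
  · rw [← Complex.norm_real x]
    exact hK x

theorem integrable_rootWeight_conj_mul (hΦ : IsMultiplicativeDistance Φ)
    (hP : (P.natDegree : ℝ) + 1 < s.re) (hQ : (Q.natDegree : ℝ) + 1 < s.re) :
    Integrable fun β : ℂ => rootWeight Φ s P (conj β) * rootWeight Φ s Q β := by
  have hs : 0 ≤ s.re := by grind
  obtain ⟨K, hK⟩ := exists_norm_rootWeight_le hΦ hs P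
  obtain ⟨K', hK'⟩ := exists_norm_rootWeight_le hΦ hs Q
  refine integrable_of_norm_le_one_add_norm_rpow (((continuous_rootWeight hΦ s P).comp
    Complex.continuous_conj).mul (continuous_rootWeight hΦ s Q)) (K := K * K')
    (r := (s.re - P.natDegree) + (s.re - Q.natDegree)) ?_ fun β => ?_
  · rw [Complex.finrank_real_complex, Nat.cast_ofNat]
    linarith
  have hβ := hK (conj β)
  rw [RCLike.norm_conj] at hβ
  calc ‖rootWeight Φ s P (conj β) * rootWeight Φ s Q β‖
      ≤ (K * (1 + ‖β‖) ^ (-(s.re - P.natDegree))) *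
        (K' * (1 + ‖β‖) ^ (-(s.re - Q.natDegree))) := by
        rw [norm_mul]
        exact mul_le_mul hβ (hK' β) (norm_nonneg _) ((norm_nonneg _).trans hβ)
    _ = (K * K') * (1 + ‖β‖) ^ (-((s.re - P.natDegree) + (s.re - Q.natDegree))) := by
        rw [neg_add, Real.rpow_add (by positivity)]
        ring

end Bounds

section SignSplit

theorem mul_sign_eq_indicator_sub {X : Type*} (F : X → ℂ) (τ : X → ℝ) :
    (fun x => F x * (Real.sign (τ x) : ℂ)) =
      fun x => {x | 0 < τ x}.indicator F x - {x | τ x < 0}.indicator F x := by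
  ext x
  rcases lt_trichotomy (τ x) 0 with h | h | h
  · simp [Set.indicator, h, h.not_gt, Real.sign_of_neg h]
  · simp [Set.indicator, h]
  · simp [Set.indicator, h, h.not_gt, Real.sign_of_pos h]

variable {X : Type*} [MeasurableSpace X] {μ : Measure X} {F : X → ℂ} {τ : X → ℝ}

theorem integrable_mul_sign (hF : Integrable F μ) (hτ : Measurable τ) :
    Integrable (fun x => F x * (Real.sign (τ x) : ℂ)) μ := by
  rw [mul_sign_eq_indicator_sub]
  exact (hF.indicator (measurableSet_lt measurable_const hτ)).sub
    (hF.indicator (measurableSet_lt hτ measurable_const))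

theorem integral_mul_sign (hF : Integrable F μ) (hτ : Measurable τ) {e : X → X}
    (he : MeasurePreserving e μ μ) (he' : MeasurableEmbedding e) (h : ∀ x, τ (e x) = -τ x) :
    ∫ x, F x * (Real.sign (τ x) : ℂ) ∂μ =
      ∫ x in {x | 0 < τ x}, F x ∂μ - ∫ x in {x | 0 < τ x}, F (e x) ∂μ := by
  have hpos : MeasurableSet {x | 0 < τ x} := measurableSet_lt measurable_const hτ
  have hneg : MeasurableSet {x | τ x < 0} := measurableSet_lt hτ measurable_const
  have hpre : e ⁻¹' {x | τ x < 0} = {x | 0 < τ x} := by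
    ext x
    simp [h]
  rw [mul_sign_eq_indicator_sub, integral_sub (hF.indicator hpos) (hF.indicator hneg),
    integral_indicator hpos, integral_indicator hneg,
    ← he.setIntegral_preimage_emb he' F {x | τ x < 0}, hpre]

end SignSplit

section Forms

open Polynomial
open scoped ComplexConjugate

theorem measurableEmbedding_swap : MeasurableEmbedding (Prod.swap : ℝ × ℝ → ℝ × ℝ) :=
  (MeasurableEquiv.prodComm : ℝ × ℝ ≃ᵐ ℝ × ℝ).measurableEmbedding

theorem measurePreserving_conj : MeasurePreserving (conj : ℂ → ℂ) :=
  Complex.conjLIE.measurePreserving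

theorem measurableEmbedding_conj : MeasurableEmbedding (conj : ℂ → ℂ) :=
  Complex.conjLIE.toHomeomorph.measurableEmbedding

theorem sub_smul_div_ofReal_sub {x y : ℝ} (h : x < y) (z : ℂ) :
    (y - x) • (z / ((y : ℂ) - x)) = z := by
  rw [Complex.real_smul, Complex.ofReal_sub]
  exact mul_div_cancel₀ z (sub_ne_zero.2 (Complex.ofReal_injective.ne h.ne'))

theorem four_mul_im_smul_div_sub_conj {β : ℂ} (h : 0 < β.im) (z : ℂ) :
    (4 * β.im) • (z / (β - conj β)) = -2 * Complex.I * z := by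
  have him : (β.im : ℂ) ≠ 0 := Complex.ofReal_ne_zero.2 h.ne'
  rw [Complex.real_smul, Complex.sub_conj]
  push_cast
  field_simp
  rw [Complex.I_sq]
  ring

variable {Φ : ℂ[X] → ℝ} {s : ℂ} {P Q : ℂ[X]}

/-- The part of `⟨P, Q⟩` carried by the pairs `x < y` of real numbers and by the upper half plane,
where the signs in the integrands are `+1`. -/
noncomputable def plusForm (Φ : ℂ[X] → ℝ) (s : ℂ) (P Q : ℂ[X]) : ℂ :=
  (∫ p in {p : ℝ × ℝ | p.1 < p.2}, rootWeight Φ s P p.1 * rootWeight Φ s Q p.2) +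
    -2 * Complex.I * ∫ β in {β : ℂ | 0 < β.im}, rootWeight Φ s P (conj β) * rootWeight Φ s Q β

theorem lineDensity_weight (hΦ : IsMultiplicativeDistance Φ) (s : ℂ) (P : ℂ[X]) :
    lineDensity (weight hΦ s) P = lineIntegrand Φ s P := by
  ext x
  simp only [lineDensity, weight_apply, lineIntegrand, rootFunction, Polynomial.map_sub, map_X,
    map_C, Complex.coe_algebraMap]

theorem pairDensity_weight (hΦ : IsMultiplicativeDistance Φ) (s : ℂ) (P Q : ℂ[X]) :
    pairDensity (weight hΦ s) P Q = fun q =>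
      rootWeight Φ s P (lowRoot q) * rootWeight Φ s Q (highRoot q) /
        (highRoot q - lowRoot q) := by
  ext q
  rw [pairDensity, weight_apply, map_monicPoly_two, hΦ.map_mul, Complex.ofReal_mul,
    Complex.mul_cpow_ofReal_nonneg (hΦ.nonneg _) (hΦ.nonneg _), mul_mul_mul_comm]
  rfl

theorem integrable_rootWeight_mul (hΦ : IsMultiplicativeDistance Φ)
    (hP : (P.natDegree : ℝ) + 1 < s.re) (hQ : (Q.natDegree : ℝ) + 1 < s.re) :
    Integrable fun p : ℝ × ℝ => rootWeight Φ s P p.1 * rootWeight Φ s Q p.2 :=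
  (integrable_lineIntegrand hΦ hP).mul_prod (integrable_lineIntegrand hΦ hQ)

theorem integral_pairDensity_weight (hΦ : IsMultiplicativeDistance Φ)
    (hP : (P.natDegree : ℝ) + 1 < s.re) (hQ : (Q.natDegree : ℝ) + 1 < s.re) :
    Integrable (pairDensity (weight hΦ s) P Q) ∧
      ∫ q, pairDensity (weight hΦ s) P Q q = plusForm Φ s P Q := by
  have hlt : MeasurableSet {p : ℝ × ℝ | p.1 < p.2} := measurableSet_lt measurable_fst measurable_snd
  have him : MeasurableSet {β : ℂ | 0 < β.im} :=
    measurableSet_lt measurable_const Complex.measurable_im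
  let H : ℂ → ℂ → ℂ := fun a b => rootWeight Φ s P a * rootWeight Φ s Q b / (b - a)
  have hreal : Set.EqOn (fun p : ℝ × ℝ => rootWeight Φ s P p.1 * rootWeight Φ s Q p.2)
      (fun p => (p.2 - p.1) • H p.1 p.2) {p | p.1 < p.2} := fun p hp =>
    (sub_smul_div_ofReal_sub hp _).symm
  have hconj : Set.EqOn
      (fun β : ℂ => -2 * Complex.I * (rootWeight Φ s P (conj β) * rootWeight Φ s Q β))
      (fun β => (4 * β.im) • H (conj β) β) {β | 0 < β.im} := fun β hβ =>
    (four_mul_im_smul_div_sub_conj hβ _).symm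
  obtain ⟨hint, heq⟩ := integral_comp_roots (H := H)
    ((integrable_rootWeight_mul hΦ hP hQ).integrableOn.congr_fun hreal hlt)
    (((integrable_rootWeight_conj_mul hΦ hP hQ).const_mul _).integrableOn.congr_fun hconj him)
  rw [pairDensity_weight]
  refine ⟨hint, heq.trans ?_⟩
  rw [← setIntegral_congr_fun hlt hreal, ← setIntegral_congr_fun him hconj, plusForm,
    integral_const_mul]

theorem realIntegrand_eq (Φ : ℂ[X] → ℝ) (s : ℂ) (P Q : ℂ[X]) : realIntegrand Φ s P Q = fun p =>
    rootWeight Φ s P p.1 * rootWeight Φ s Q p.2 * (Real.sign (p.2 - p.1) : ℂ) := by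
  ext p
  simp only [realIntegrand, rootWeight]
  ring

theorem complexIntegrand_eq (Φ : ℂ[X] → ℝ) (s : ℂ) (P Q : ℂ[X]) :
    complexIntegrand Φ s P Q = fun β =>
      rootWeight Φ s P (conj β) * rootWeight Φ s Q β * (Real.sign β.im : ℂ) := by
  ext β
  simp only [complexIntegrand, rootWeight]
  ring

theorem integrable_realIntegrand (hΦ : IsMultiplicativeDistance Φ)
    (hP : (P.natDegree : ℝ) + 1 < s.re) (hQ : (Q.natDegree : ℝ) + 1 < s.re) :
    Integrable (realIntegrand Φ s P Q) := by
  rw [realIntegrand_eq]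
  exact integrable_mul_sign (integrable_rootWeight_mul hΦ hP hQ)
    (measurable_snd.sub measurable_fst)

theorem integrable_complexIntegrand (hΦ : IsMultiplicativeDistance Φ)
    (hP : (P.natDegree : ℝ) + 1 < s.re) (hQ : (Q.natDegree : ℝ) + 1 < s.re) :
    Integrable (complexIntegrand Φ s P Q) := by
  rw [complexIntegrand_eq]
  exact integrable_mul_sign (integrable_rootWeight_conj_mul hΦ hP hQ) Complex.measurable_im

theorem skewForm_eq_plusForm_sub (hΦ : IsMultiplicativeDistance Φ)
    (hP : (P.natDegree : ℝ) + 1 < s.re) (hQ : (Q.natDegree : ℝ) + 1 < s.re) :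
    skewForm Φ s P Q = plusForm Φ s P Q - plusForm Φ s Q P := by
  have hreal : realForm Φ s P Q =
      (∫ p in {p : ℝ × ℝ | p.1 < p.2}, rootWeight Φ s P p.1 * rootWeight Φ s Q p.2) -
        ∫ p in {p : ℝ × ℝ | p.1 < p.2}, rootWeight Φ s Q p.1 * rootWeight Φ s P p.2 := by
    rw [realForm, realIntegrand_eq]
    refine (integral_mul_sign (τ := fun p : ℝ × ℝ => p.2 - p.1)
      (integrable_rootWeight_mul hΦ hP hQ) (measurable_snd.sub measurable_fst)
      Measure.measurePreserving_swap measurableEmbedding_swap fun p => (neg_sub _ _).symm).trans ?_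
    simp only [sub_pos, Prod.fst_swap, Prod.snd_swap, mul_comm]
  have hcomplex : ∫ β, complexIntegrand Φ s P Q β =
      (∫ β in {β : ℂ | 0 < β.im}, rootWeight Φ s P (conj β) * rootWeight Φ s Q β) -
        ∫ β in {β : ℂ | 0 < β.im}, rootWeight Φ s Q (conj β) * rootWeight Φ s P β := by
    rw [complexIntegrand_eq, integral_mul_sign (integrable_rootWeight_conj_mul hΦ hP hQ)
      Complex.measurable_im measurePreserving_conj measurableEmbedding_conj Complex.conj_im]
    simp only [Complex.conj_conj, mul_comm]
  rw [skewForm, complexForm, hreal, hcomplex, plusForm, plusForm]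
  ring

end Forms

section Parity

open Polynomial
open scoped ComplexConjugate

theorem eval_map_neg {P : ℝ[X]} {ε : ℝ} (h : ∀ x, P.eval (-x) = ε * P.eval x) (z : ℂ) :
    (P.map (algebraMap ℝ ℂ)).eval (-z) = ε * (P.map (algebraMap ℝ ℂ)).eval z := by
  have hcomp : P.comp (-X) = C ε * P := Polynomial.funext fun x => by simp [h]
  simpa [Polynomial.map_comp] using congrArg (fun f => (f.map (algebraMap ℝ ℂ)).eval z) hcomp

theorem eval_map_neg_of_even_of_odd {P : ℝ[X]} {n : ℕ}
    (heven : Even n → Function.Even fun x : ℝ => P.eval x)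
    (hodd : Odd n → Function.Odd fun x : ℝ => P.eval x) (z : ℂ) :
    (P.map (algebraMap ℝ ℂ)).eval (-z) = (-1) ^ n * (P.map (algebraMap ℝ ℂ)).eval z := by
  rcases n.even_or_odd with h | h
  · simpa [h.neg_one_pow] using
      eval_map_neg (ε := 1) (fun x => (heven h x).trans (one_mul _).symm) z
  · simpa [h.neg_one_pow] using
      eval_map_neg (ε := -1) (fun x => (hodd h x).trans (neg_one_mul _).symm) z

variable {Φ : ℂ[X] → ℝ} {s : ℂ} {P Q : ℂ[X]} {ε : ℂ}

theorem rootWeight_neg (hsymm : ∀ β, rootFunction Φ (-β) = rootFunction Φ β)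
    (hP : ∀ z, P.eval (-z) = ε * P.eval z) (z : ℂ) :
    rootWeight Φ s P (-z) = ε * rootWeight Φ s P z := by
  rw [rootWeight, hsymm, hP, rootWeight, mul_left_comm]

theorem plusForm_comm (hsymm : ∀ β, rootFunction Φ (-β) = rootFunction Φ β)
    (hε : ε * ε = 1) (hP : ∀ z, P.eval (-z) = ε * P.eval z)
    (hQ : ∀ z, Q.eval (-z) = ε * Q.eval z) : plusForm Φ s P Q = plusForm Φ s Q P := by
  have hmul : ∀ a b, rootWeight Φ s P (-a) * rootWeight Φ s Q (-b) =
      rootWeight Φ s Q b * rootWeight Φ s P a := fun a b => by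
    rw [rootWeight_neg hsymm hP, rootWeight_neg hsymm hQ]
    linear_combination rootWeight Φ s P a * rootWeight Φ s Q b * hε
  have hreal := ((Measure.measurePreserving_neg (volume : Measure (ℝ × ℝ))).comp
    Measure.measurePreserving_swap).setIntegral_preimage_emb
    ((MeasurableEquiv.neg _).measurableEmbedding.comp measurableEmbedding_swap)
    (fun p : ℝ × ℝ => rootWeight Φ s P p.1 * rootWeight Φ s Q p.2) {p | p.1 < p.2}
  have hcomplex := ((Measure.measurePreserving_neg (volume : Measure ℂ)).comp
    measurePreserving_conj).setIntegral_preimage_emb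
    ((MeasurableEquiv.neg _).measurableEmbedding.comp measurableEmbedding_conj)
    (fun β : ℂ => rootWeight Φ s P (conj β) * rootWeight Φ s Q β) {β | 0 < β.im}
  rw [plusForm, plusForm, ← hreal, ← hcomplex]
  simp [hmul, Set.preimage, Measure.volume_eq_prod]

theorem integral_lineIntegrand_eq_zero (hsymm : ∀ β, rootFunction Φ (-β) = rootFunction Φ β)
    (hP : ∀ z, P.eval (-z) = -P.eval z) : ∫ x, lineIntegrand Φ s P x = 0 := by
  have hneg : ∀ x : ℝ, lineIntegrand Φ s P (-x) = -lineIntegrand Φ s P x := fun x => by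
    simp only [lineIntegrand, Complex.ofReal_neg, hsymm, hP, mul_neg]
  refine self_eq_neg.1 ?_
  rw [← integral_neg, ← integral_neg_eq_self]
  simp only [hneg]

end Parity

section Determinant

open Polynomial

variable {Φ : ℂ[X] → ℝ} {s : ℂ} {N : ℕ} {P : Fin N → ℂ[X]}

theorem matrixA_apply_of_lt {r i : Fin ((N + 1) / 2)} (hr : 2 * (r : ℕ) < N)
    (hi : 2 * (i : ℕ) + 1 < N) :
    matrixA Φ s P r i = skewForm Φ s (P ⟨2 * r, hr⟩) (P ⟨2 * i + 1, hi⟩) :=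
  dif_pos ⟨hr, hi⟩

theorem matrixA_apply_of_eq {r i : Fin ((N + 1) / 2)} (hr : 2 * (r : ℕ) < N)
    (hi : 2 * (i : ℕ) + 1 = N) :
    matrixA Φ s P r i = ∫ x, lineIntegrand Φ s (P ⟨2 * r, hr⟩) x := by
  have hmin : min (2 * (r : ℕ)) (2 * i + 1) = 2 * r := by lia
  have hlt : (0 : ℝ) < ((2 * (i : ℕ) + 1 : ℕ) : ℝ) - ((2 * (r : ℕ) : ℕ) : ℝ) := by
    rw [sub_pos, Nat.cast_lt]
    lia
  simp only [matrixA, matrixU, Matrix.of_apply]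
  rw [dif_neg (by lia), dif_pos (by lia), Real.sign_of_pos hlt, Complex.ofReal_one, one_mul]
  simp only [hmin]

theorem natDegree_add_one_lt_re (hs : (N : ℝ) < s.re) (hdeg : ∀ j, (P j).natDegree = j)
    (j : Fin N) : ((P j).natDegree : ℝ) + 1 < s.re := by
  rw [hdeg]
  exact lt_of_le_of_lt (mod_cast j.2) hs

theorem plusForm_comm_of_parity (hsymm : ∀ β, rootFunction Φ (-β) = rootFunction Φ β)
    (hpar : ∀ j z, (P j).eval (-z) = (-1) ^ (j : ℕ) * (P j).eval z) (j k : Fin N)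
    (h : (j : ℕ) % 2 = k % 2) : plusForm Φ s (P j) (P k) = plusForm Φ s (P k) (P j) := by
  refine plusForm_comm hsymm (ε := (-1) ^ (j : ℕ)) ?_ (hpar j) fun z => ?_
  · rw [← mul_pow, neg_one_mul, neg_neg, one_pow]
  · rw [hpar, neg_one_pow_eq_pow_mod_two, ← h, ← neg_one_pow_eq_pow_mod_two]

theorem factorial_mul_momentFunction (hΦ : IsMultiplicativeDistance Φ) {M J : ℕ} (hM : M ≤ 1)
    {P : Fin (M + 2 * J) → ℂ[X]} (hs : ((M + 2 * J : ℕ) : ℝ) < s.re)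
    (hmonic : ∀ j, (P j).Monic) (hdeg : ∀ j, (P j).natDegree = j) :
    (J.factorial : ℂ) * momentFunction Φ (M + 2 * J) s =
      ∑ σ : Equiv.Perm (Fin (M + 2 * J)), (Equiv.Perm.sign σ : ℂ) *
        ((∏ i, plusForm Φ s (P (σ (pairIdx M (i, 0)))) (P (σ (pairIdx M (i, 1))))) *
          ∏ c, ∫ x, lineIntegrand Φ s (P (σ (lastIdx J c))) x) := by
  have hnd := natDegree_add_one_lt_re hs hdeg
  have hB := fun j k => integral_pairDensity_weight hΦ (hnd j) (hnd k)
  have hL : ∀ j, Integrable (lineDensity (weight hΦ s) (P j)) := fun j => by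
    rw [lineDensity_weight]
    exact integrable_lineIntegrand hΦ (hnd j)
  rw [momentFunction_eq_integral_weight hΦ, factorial_mul_integral_eq_sum hM (weight hΦ s)
    (add_comm _ _) (continuous_weight_monicPoly hΦ s _).stronglyMeasurable
    (integrable_weight_monicPoly hΦ hs) hmonic hdeg (fun j k => (hB j k).1) hL]
  simp only [lineDensity_weight, fun j k => (hB j k).2]

theorem momentFunction_eq_det_of_even (hΦ : IsMultiplicativeDistance Φ)
    (hsymm : ∀ β, rootFunction Φ (-β) = rootFunction Φ β) {J : ℕ} {P : Fin (0 + 2 * J) → ℂ[X]}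
    (hs : ((0 + 2 * J : ℕ) : ℝ) < s.re) (hmonic : ∀ j, (P j).Monic)
    (hdeg : ∀ j, (P j).natDegree = j)
    (hpar : ∀ j z, (P j).eval (-z) = (-1) ^ (j : ℕ) * (P j).eval z) :
    momentFunction Φ (0 + 2 * J) s = (matrixA Φ s P).det := by
  have hnd := natDegree_add_one_lt_re hs hdeg
  have h := factorial_mul_momentFunction hΦ zero_le_one hs hmonic hdeg
  simp only [Finset.univ_eq_empty, Finset.prod_empty, mul_one] at h
  rw [sum_perm_pairs_even (B := fun j k => plusForm Φ s (P j) (P k))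
    (plusForm_comm_of_parity hsymm hpar)] at h
  rw [mul_left_cancel₀ (Nat.cast_ne_zero.2 J.factorial_ne_zero) h,
    ← Matrix.det_submatrix_equiv_self (finCongr (by lia : J = (0 + 2 * J + 1) / 2))]
  congr 1
  ext r i
  rw [Matrix.submatrix_apply, matrixA_apply_of_lt (by grind) (by grind),
    skewForm_eq_plusForm_sub hΦ (hnd _) (hnd _)]
  rfl

theorem momentFunction_eq_det_of_odd (hΦ : IsMultiplicativeDistance Φ)
    (hsymm : ∀ β, rootFunction Φ (-β) = rootFunction Φ β) {J : ℕ} {P : Fin (1 + 2 * J) → ℂ[X]}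
    (hs : ((1 + 2 * J : ℕ) : ℝ) < s.re) (hmonic : ∀ j, (P j).Monic)
    (hdeg : ∀ j, (P j).natDegree = j)
    (hpar : ∀ j z, (P j).eval (-z) = (-1) ^ (j : ℕ) * (P j).eval z) :
    momentFunction Φ (1 + 2 * J) s = (matrixA Φ s P).det := by
  have hnd := natDegree_add_one_lt_re hs hdeg
  have hzero : ∀ j : Fin (1 + 2 * J), (j : ℕ) % 2 = 1 → ∫ x, lineIntegrand Φ s (P j) x = 0 :=
    fun j hj => integral_lineIntegrand_eq_zero hsymm fun z => by
      rw [hpar, (Nat.odd_iff.2 hj).neg_one_pow, neg_one_mul]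
  have h := factorial_mul_momentFunction hΦ le_rfl hs hmonic hdeg
  simp only [Fin.prod_univ_one] at h
  rw [sum_perm_pairs_odd (B := fun j k => plusForm Φ s (P j) (P k))
    (plusForm_comm_of_parity hsymm hpar) hzero] at h
  rw [mul_left_cancel₀ (Nat.cast_ne_zero.2 J.factorial_ne_zero) h,
    ← Matrix.det_submatrix_equiv_self (finCongr (by lia : J + 1 = (1 + 2 * J + 1) / 2))]
  congr 1
  ext r i
  rw [Matrix.of_apply, Matrix.submatrix_apply]
  split_ifs with hi
  · rw [matrixA_apply_of_lt (by simp; lia) (by simp; lia),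
      skewForm_eq_plusForm_sub hΦ (hnd _) (hnd _)]
    rfl
  · rw [matrixA_apply_of_eq (by simp; lia) (by simp; lia)]
    rfl

theorem momentFunction_eq_det (hΦ : IsMultiplicativeDistance Φ)
    (hsymm : ∀ β, rootFunction Φ (-β) = rootFunction Φ β) (hs : (N : ℝ) < s.re)
    (hmonic : ∀ j, (P j).Monic) (hdeg : ∀ j, (P j).natDegree = j)
    (hpar : ∀ j z, (P j).eval (-z) = (-1) ^ (j : ℕ) * (P j).eval z) :
    momentFunction Φ N s = (matrixA Φ s P).det := by
  obtain ⟨J, rfl | rfl⟩ : ∃ J, N = 0 + 2 * J ∨ N = 1 + 2 * J := ⟨N / 2, by lia⟩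
  · exact momentFunction_eq_det_of_even hΦ hsymm hs hmonic hdeg hpar
  · exact momentFunction_eq_det_of_odd hΦ hsymm hs hmonic hdeg hpar

end Determinant

end MultDist

theorem corollary3_general (Φ : Polynomial ℂ → ℝ) (hΦ : MultDist.IsMultiplicativeDistance Φ)
    (hsymm : ∀ β : ℂ, MultDist.rootFunction Φ (-β) = MultDist.rootFunction Φ β)
    (N : ℕ) (s : ℂ) (hs : (N : ℝ) < s.re) (P : Fin N → Polynomial ℂ)
    (hmonic : ∀ n, (P n).Monic) (hdeg : ∀ n, (P n).natDegree = (n : ℕ))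
    (hpar : ∀ n z, (P n).eval (-z) = (-1) ^ (n : ℕ) * (P n).eval z) :
    Integrable (MultDist.momentIntegrand Φ N s) ∧
    (∀ j k : Fin N,
      Integrable (MultDist.realIntegrand Φ s (P j) (P k)) ∧
      Integrable (MultDist.complexIntegrand Φ s (P j) (P k))) ∧
    (∀ j : Fin N, Integrable (MultDist.lineIntegrand Φ s (P j))) ∧
    MultDist.momentFunction Φ N s = (MultDist.matrixA Φ s P).det :=
  have hnd := MultDist.natDegree_add_one_lt_re hs hdeg
  ⟨MultDist.integrable_momentIntegrand hΦ hs,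
    fun j k => ⟨MultDist.integrable_realIntegrand hΦ (hnd j) (hnd k),
      MultDist.integrable_complexIntegrand hΦ (hnd j) (hnd k)⟩,
    fun j => MultDist.integrable_lineIntegrand hΦ (hnd j),
    MultDist.momentFunction_eq_det hΦ hsymm hs hmonic hdeg hpar⟩

theorem corollary3 (Φ : Polynomial ℂ → ℝ) (hΦ : MultDist.IsMultiplicativeDistance Φ)
    (hsymm : ∀ β : ℂ, MultDist.rootFunction Φ (-β) = MultDist.rootFunction Φ β)
    (N : ℕ) (s : ℂ) (hs : (N : ℝ) < s.re)
    (P : Fin N → Polynomial ℝ)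
    (hmonic : ∀ n, (P n).Monic)
    (hdeg : ∀ n, (P n).natDegree = (n : ℕ))
    (heven : ∀ n : Fin N, Even (n : ℕ) → Function.Even fun x : ℝ => (P n).eval x)
    (hodd : ∀ n : Fin N, Odd (n : ℕ) → Function.Odd fun x : ℝ => (P n).eval x) :
    -- the integrals defining `F_N` and the entries of `U_P` converge absolutely
    MeasureTheory.Integrable (MultDist.momentIntegrand Φ N s) ∧
    (∀ j k : Fin N,
      MeasureTheory.Integrable (MultDist.realIntegrand Φ s
        ((P j).map (algebraMap ℝ ℂ)) ((P k).map (algebraMap ℝ ℂ))) ∧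
      MeasureTheory.Integrable (MultDist.complexIntegrand Φ s
        ((P j).map (algebraMap ℝ ℂ)) ((P k).map (algebraMap ℝ ℂ)))) ∧
    (∀ j : Fin N,
      MeasureTheory.Integrable (MultDist.lineIntegrand Φ s ((P j).map (algebraMap ℝ ℂ)))) ∧
    MultDist.momentFunction Φ N s =
      (MultDist.matrixA Φ s fun n => (P n).map (algebraMap ℝ ℂ)).det :=
  corollary3_general Φ hΦ hsymm N s hs _ (fun n => (hmonic n).map _)
    (fun n => (Polynomial.natDegree_map _).trans (hdeg n))
    fun n z => MultDist.eval_map_neg_of_even_of_odd (heven n) (hodd n) z
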